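/- Let $\sigma\in(0,2)$, $m\ge 1$, $X,Y,T>0$, $\Omega=(-X,X)\times(0,Y)$, let $f\ge 0$ on $[-X,X]$, and put $\mu_\sigma=2^{\sigma-1}\Gamma(\sigma/2)/\Gamma(1-\sigma/2)$, $\nu_\sigma=\sigma\mu_\sigma$, $L_\sigma v=\nabla\cdot(y^{1-\sigma}\nabla v)$ and $\frac{\partial v}{\partial y^\sigma}(x,0)=\mu_\sigma\lim_{y\to0^+}y^{1-\sigma}\frac{\partial v}{\partial y}(x,y)$. Let $w\ge 0$ be a classical solution (continuous on $\overline\Omega\times[0,T]$, and $C^2$ in $(x,y)\in\Omega$ for each $t\in(0,T]$) of $$L_\sigma w=0 \text{ in }\Omega,\qquad \frac{\partial w^{1/m}}{\partial t}(x,0,t)=\frac{\partial w}{\partial y^\sigma}(x,0,t)\ \ (|x|\le X),\qquad 0<t\le T,$$ with $w(x,0,0)=f(x)^m$ for $|x|\le X$, and $w=0$ on the lateral boundary $\{x=\pm X\}\cup\{y=Y\}$. Put $u=w^{1/m}$ and $\varphi(u)=u^m$, and assume that $w$ is regular in the following sense: $\partial_{xx}w$ is bounded on $\Omega\times(0,T]$;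 $u(x,0,\cdot)$ is $C^2$ on $(0,T]$ with second derivative bounded uniformly in $x\in[-X,X]$; and there is a constant $K_0$ with $|\varphi'(u(x,y,t))-\varphi'(u(x,0,t))|\le K_0\,y^\sigma$ for $(x,y)\in\overline\Omega$, $t\in(0,T]$. For integers $I,K,J\ge1$ with $\Delta x=2X/I=Y/K$ let $\Delta t=T/J$, $x_i=i\Delta x-X$, $y_k=k\Delta x$, $t_j=j\Delta t$. On each such mesh let a linear operator $L^D_\sigma$ on grid functions be given which satisfies the discrete maximum principle: if $L^D_\sigma V\ge0$ at all interior nodes ($0<i<I$, $0<k<K$) and $V\le b$ at all boundary nodes, where $b\ge0$, then $V\le b$ at all nodes. We say that $L_\sigma^D$ has order $a$ if, for a class of (regular enough) functions $v(x,y,t)$ that contains $w$ and all polynomials in $(x,y)$ of degree at most two, $$\max_{i,k}\big|L_\sigma^D[v(x_i,y_k,t)]-L_\sigma v(x_i,y_k,t)\big|\le C_v\,\Delta x^a,$$ the maximum being over interior nodes, with $C_v$ independent of the mesh and of $t\in(0,T]$. Let $(W_j)_i^k$, $0\le j\le J$, solve the numerical method: $L^D_\sigma[(W_j)_i^k]=0$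 at interior nodes; $(W_j)_i^k=0$ if $i\in\{0,I\}$ or $k=K$; and for $0<i<I$, $(W_0)_i^0=f(x_i)^m$ and $$(W_j)_i^0=\Big[\nu_\sigma\tfrac{\Delta t}{\Delta x^\sigma}\big((W_{j-1})_i^1-(W_{j-1})_i^0\big)+[(W_{j-1})_i^0]^{1/m}\Big]^m,\qquad 1\le j\le J.$$ Put $F_J=\max_{0\le i\le I,\,0\le k\le K}|w(x_i,y_k,T)-(W_J)_i^k|$ and $C(m,f)=[m\|f\|_\infty^{m-1}\nu_\sigma]^{-1}$ (with $C(m,f)=+\infty$ if $f\equiv0$ and $m>1$), and assume $\Delta t\le C(m,f)\Delta x^\sigma$. Let $D>0$. (i) If $\sigma\in(0,1]$ and $L_\sigma^D$ has order $a=2(2-\sigma)$, then $F_J=O(\Delta x^{2-\sigma})$ over all meshes with $D\Delta x^{2-\sigma}\le\Delta t\le C(m,f)\Delta x^{2-\sigma}$. (ii) If $\sigma\in(1,2)$ and $L_\sigma^D$ has order $a=2$, then $F_J=O(\Delta x^{2-\sigma})$ over all meshes with $D\Delta x^{\sigma}\le\Delta t\le C(m,f)\Delta x^{\sigma}$. In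 both cases the implied constant does not depend on the mesh $(I,K,J)$. -/

import Mathlib

open Set Filter Topology

namespace FracPME

noncomputable section

/-- `μ_σ = 2^(σ-1) Γ(σ/2) / Γ(1-σ/2)`. -/
def mu (σ : ℝ) : ℝ :=
  (2 : ℝ) ^ (σ - 1) * Real.Gamma (σ / 2) / Real.Gamma (1 - σ / 2)

/-- `ν_σ = σ μ_σ`. -/
def nu (σ : ℝ) : ℝ := σ * mu σ

/-- The extension operator `L_σ v = ∇ · (y^(1-σ) ∇v)` at the point `(x, y)`. -/
def extOp (σ : ℝ) (v : ℝ → ℝ → ℝ) (x y : ℝ) : ℝ :=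
  deriv (fun ξ => y ^ (1 - σ) * deriv (fun ξ' => v ξ' y) ξ) x +
    deriv (fun η => η ^ (1 - σ) * deriv (fun η' => v x η') η) y

/-- The normalized `σ`-derivative of `v` at `(x, 0)` exists and equals `q`:
`μ_σ y^(1-σ) ∂v/∂y (x, y) → q` as `y → 0+`. -/
def HasSigmaDeriv (σ : ℝ) (v : ℝ → ℝ → ℝ) (x q : ℝ) : Prop :=
  Tendsto (fun y => mu σ * (y ^ (1 - σ) * deriv (fun η => v x η) y)) (𝓝[>] 0) (𝓝 q)

/-- `w (x, y, t)` is a (nonnegative) classical solution, with datum `f`, of the extension problem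
in the rectangle `Ω = (-X, X) × (0, Y)` for times in `(0, T]`. -/
structure IsClassicalSolution (σ m X Y T : ℝ) (f : ℝ → ℝ) (w : ℝ → ℝ → ℝ → ℝ) : Prop where
  continuousOn : ContinuousOn (fun p : ℝ × ℝ × ℝ => w p.1 p.2.1 p.2.2)
    (Icc (-X) X ×ˢ Icc 0 Y ×ˢ Icc 0 T)
  nonneg : ∀ x ∈ Icc (-X) X, ∀ y ∈ Icc 0 Y, ∀ t ∈ Icc 0 T, 0 ≤ w x y t
  contDiffOn : ∀ t ∈ Ioc 0 T,
    ContDiffOn ℝ 2 (fun p : ℝ × ℝ => w p.1 p.2 t) (Ioo (-X) X ×ˢ Ioo 0 Y)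
  interior_eq : ∀ t ∈ Ioc 0 T, ∀ x ∈ Ioo (-X) X, ∀ y ∈ Ioo 0 Y,
    extOp σ (fun x y => w x y t) x y = 0
  base_eq : ∀ t ∈ Ioc 0 T, ∀ x ∈ Icc (-X) X, ∃ q : ℝ,
    HasDerivWithinAt (fun s => w x 0 s ^ (1 / m)) q (Ioc 0 T) t ∧
      HasSigmaDeriv σ (fun x y => w x y t) x q
  initial_eq : ∀ x ∈ Icc (-X) X, w x 0 0 = f x ^ m
  lateral_eq : ∀ t ∈ Icc 0 T, ∀ x ∈ Icc (-X) X, ∀ y ∈ Ioc 0 Y,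
    (x = -X ∨ x = X ∨ y = Y) → w x y t = 0

/-- The regularity of the solution `w` and of `u = w^(1/m)`: `w` is `C²` in `x` and
`u (x, 0, ·)` is `C²` in `t`, both with bounded second derivatives, and `φ'(u) = m u^(m-1)`
satisfies `|φ'(u(x, y, t)) - φ'(u(x, 0, t))| ≤ K y^σ`. (That `w` is `C²` inside `Ω` is part of
`IsClassicalSolution`.) -/
structure IsRegular (σ m X Y T : ℝ) (w : ℝ → ℝ → ℝ → ℝ) : Prop where
  xx : ∃ M : ℝ, ∀ t ∈ Ioc 0 T, ∀ x ∈ Ioo (-X) X, ∀ y ∈ Ioo 0 Y,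
    |iteratedDeriv 2 (fun ξ => w ξ y t) x| ≤ M
  tt : ∃ M : ℝ, ∀ x ∈ Icc (-X) X,
    ContDiffOn ℝ 2 (fun s => w x 0 s ^ (1 / m)) (Ioc 0 T) ∧
      ∀ t ∈ Ioc 0 T, |iteratedDerivWithin 2 (fun s => w x 0 s ^ (1 / m)) (Ioc 0 T) t| ≤ M
  slope : ∃ K : ℝ, ∀ t ∈ Ioc 0 T, ∀ x ∈ Icc (-X) X, ∀ y ∈ Icc 0 Y,
    |m * (w x y t ^ (1 / m)) ^ (m - 1) - m * (w x 0 t ^ (1 / m)) ^ (m - 1)| ≤ K * y ^ σ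

/-- A uniform mesh of `[-X, X] × [0, Y]` with `I` and `K` steps and `Δx = Δy`. -/
structure Mesh (X Y : ℝ) where
  I : ℕ
  K : ℕ
  I_pos : 0 < I
  K_pos : 0 < K
  square : 2 * X / I = Y / K

namespace Mesh

variable {X Y : ℝ}

/-- The mesh size `Δx = Δy`. -/
def dx (M : Mesh X Y) : ℝ := 2 * X / M.I

/-- Functions on the nodes `(x_i, y_k)`, `0 ≤ i ≤ I`, `0 ≤ k ≤ K`. -/
abbrev Grid (M : Mesh X Y) : Type := Fin (M.I + 1) → Fin (M.K + 1) → ℝ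

/-- `x_i = i Δx - X`. -/
def x (M : Mesh X Y) (i : Fin (M.I + 1)) : ℝ := (i : ℕ) * M.dx - X

/-- `y_k = k Δy`, where `Δy = Δx`. -/
def y (M : Mesh X Y) (k : Fin (M.K + 1)) : ℝ := (k : ℕ) * M.dx

/-- Restriction of a function to the nodes. -/
def sample (M : Mesh X Y) (v : ℝ → ℝ → ℝ) : M.Grid := fun i k => v (M.x i) (M.y k)

/-- The nodes with `0 < i < I`. -/
def InnerCol (M : Mesh X Y) (i : Fin (M.I + 1)) : Prop := 0 < (i : ℕ) ∧ (i : ℕ) < M.I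

/-- The nodes with `0 < k < K`. -/
def InnerRow (M : Mesh X Y) (k : Fin (M.K + 1)) : Prop := 0 < (k : ℕ) ∧ (k : ℕ) < M.K

/-- The nodes of the lateral boundary: `i = 0`, `i = I` or `k = K`. -/
def Lateral (M : Mesh X Y) (i : Fin (M.I + 1)) (k : Fin (M.K + 1)) : Prop :=
  (i : ℕ) = 0 ∨ (i : ℕ) = M.I ∨ (k : ℕ) = M.K

end Mesh

/-- A finite difference operator: on every mesh, a linear operator on grid functions
(only its values at interior nodes matter). -/
abbrev Discretization (X Y : ℝ) : Type := ∀ M : Mesh X Y, M.Grid →ₗ[ℝ] M.Grid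

/-- The discretization approximates `L_σ` with order `a` on the class `R` of functions
`v (x, y, t)`, with a constant that depends on `v` but not on the mesh, the node or the time. -/
def HasOrder (σ X Y T a : ℝ) (LD : Discretization X Y) (R : Set (ℝ → ℝ → ℝ → ℝ)) : Prop :=
  ∀ v ∈ R, ∃ C : ℝ, ∀ M : Mesh X Y, ∀ t ∈ Ioc 0 T, ∀ i k, M.InnerCol i → M.InnerRow k →
    |LD M (M.sample fun x y => v x y t) i k - extOp σ (fun x y => v x y t) (M.x i) (M.y k)|
      ≤ C * M.dx ^ a

/-- The discrete maximum principle: a discrete subsolution does not exceed a nonnegative bound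
that it satisfies at all boundary nodes. -/
def MaxPrinciple {X Y : ℝ} (LD : Discretization X Y) : Prop :=
  ∀ (M : Mesh X Y) (V : M.Grid) (b : ℝ), 0 ≤ b →
    (∀ i k, M.InnerCol i → M.InnerRow k → 0 ≤ LD M V i k) →
    (∀ i k, (M.Lateral i k ∨ (k : ℕ) = 0) → V i k ≤ b) →
    ∀ i k, V i k ≤ b

/-- `W j`, `0 ≤ j ≤ J`, is the solution of the numerical method on the mesh `M` with time
step `dt`. -/
structure IsNumericalSolution {X Y : ℝ} (σ m : ℝ) (f : ℝ → ℝ) (LD : Discretization X Y)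
    (M : Mesh X Y) (J : ℕ) (dt : ℝ) (W : ℕ → M.Grid) : Prop where
  interior : ∀ j ≤ J, ∀ i k, M.InnerCol i → M.InnerRow k → LD M (W j) i k = 0
  lateral : ∀ j ≤ J, ∀ i k, M.Lateral i k → W j i k = 0
  initial : ∀ i, M.InnerCol i → W 0 i 0 = f (M.x i) ^ m
  step : ∀ j < J, ∀ i, M.InnerCol i → ∀ k₁ : Fin (M.K + 1), (k₁ : ℕ) = 1 →
    W (j + 1) i 0 =
      (nu σ * (dt / M.dx ^ σ) * (W j i k₁ - W j i 0) + W j i 0 ^ (1 / m)) ^ m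

/-- `F_j = max_{i,k} |w(x_i, y_k, t_j) - (W_j)_i^k|`, where `t_j = j Δt`. -/
def errF {X Y : ℝ} (w : ℝ → ℝ → ℝ → ℝ) (M : Mesh X Y) (dt : ℝ) (W : ℕ → M.Grid) (j : ℕ) : ℝ :=
  ⨆ p : Fin (M.I + 1) × Fin (M.K + 1), |w (M.x p.1) (M.y p.2) (j * dt) - W j p.1 p.2|

/-- `‖f‖_∞` on `[-X, X]`, for nonnegative `f`. -/
def supNorm (X : ℝ) (f : ℝ → ℝ) : ℝ := sSup (f '' Icc (-X) X)

/-- `1 / C(m, f) = m ‖f‖_∞^(m-1) ν_σ`, the largest value of `ν_σ φ'(u)` for `0 ≤ u ≤ ‖f‖_∞`. -/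
def invC (σ m X : ℝ) (f : ℝ → ℝ) : ℝ := m * supNorm X f ^ (m - 1) * nu σ

/-- `Δt ≤ C(m, f) Δx^p`, written without division so that it is also meaningful
(and void) when `f = 0` and `m > 1`. -/
def StepBound {X Y : ℝ} (σ m : ℝ) (f : ℝ → ℝ) (M : Mesh X Y) (dt p : ℝ) : Prop :=
  invC σ m X f * dt ≤ M.dx ^ p

end

end FracPME

namespace FracPME


/-! On the base the scheme reads `U' = U - l U^m + l V`, where `U = W^(1/m)`, `V` is the value of
`W` one row up and `l = ν_σ Δt / Δx^σ`. Put `N = ‖f‖_∞` and `Φ = m N^(m-1)`. The step restriction is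
`l Φ ≤ 1`, so `U ↦ U - l U^m` is nondecreasing on `[0, N]` and the scheme is monotone. Maximum
principles keep both `u` and `U` on the base in `[0, N]`.

Consistency: integrating `(y^(1-σ) w_y)_y = -y^(1-σ) w_xx` twice from the base gives `w(x, h) = w(x,
0) + (q / ν_σ) h^σ + O(h²)`, where `q = u_t`. With Taylor's formula in time, the truncation error
`τ` of one step is `O(Δt² + Δt Δx^(2-σ))` (`exists_consistency`). In the interior the truncation
error is `O(Δx^a)`; a barrier and the discrete maximum principle turn it into a term `ε = O(Δx^a)`
added to the error on the base (`exists_stability`).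

Stability: the discrete maximum principle controls errors in `w = u^m`, but the time step acts on
`u`. An error `r` in `u` that survives from `u` to `u'` is worth `(u' + r)^m - u'^m` in `w`, which
may exceed `(u + r)^m - u^m`. For `m > 1` the condition on `φ'(u)` yields `u_t ≤ A u`
(`sigmaDeriv_le`), so `u' ≤ e^(A Δt) u`, and convexity and homogeneity limit the amplification to
`e^(m A Δt)` (`step_error_upper`, `step_error_lower`). For `m = 1` there is no amplification.

Each of the `J` steps contributes `Φ (τ + l ε)` up to bounded exponential factors. Since `J Δt = T`,
the total is of the order of `Φ (Δt + Δx^(2-σ) + Δx^(a-σ)) + Δx^a`, which is `O(Δx^(2-σ))` because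
`a ≥ 2` and `Φ Δt = O(Δx^(2-σ))` in both regimes. -/

theorem mu_pos {σ : ℝ} (h0 : 0 < σ) (h2 : σ < 2) : 0 < mu σ := by
  unfold mu
  have h₁ : 0 < Real.Gamma (σ / 2) := Real.Gamma_pos_of_pos (by linarith)
  have h₂ : 0 < Real.Gamma (1 - σ / 2) := Real.Gamma_pos_of_pos (by linarith)
  positivity

theorem nu_pos {σ : ℝ} (h0 : 0 < σ) (h2 : σ < 2) : 0 < nu σ :=
  mul_pos h0 (mu_pos h0 h2)

/-! ### Maximum principles for the exact solution -/

/-- The necessary second order condition at a local maximum. -/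
theorem deriv_deriv_nonpos_of_isLocalMax {g : ℝ → ℝ} {x : ℝ} (hg : IsLocalMax g x)
    (hc : ContinuousAt g x) : deriv (deriv g) x ≤ 0 := by
  by_contra! h
  -- A positive second derivative makes `x` a local minimum as well, so `g` is locally constant,
  -- which contradicts `h`.
  have hmin : IsLocalMin g x := isLocalMin_of_deriv_deriv_pos h hg.deriv_eq_zero hc
  have heq : g =ᶠ[𝓝 x] fun _ => g x := by
    filter_upwards [hg, hmin] with y h₁ h₂
    exact le_antisymm h₁ h₂
  have h0 : deriv (deriv g) x = 0 := by
    rw [heq.deriv.deriv_eq]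
    simp
  exact h.ne' h0

theorem IsClassicalSolution.slice_x {σ m X Y T : ℝ} {f : ℝ → ℝ} {w : ℝ → ℝ → ℝ → ℝ}
    (hw : IsClassicalSolution σ m X Y T f w) {t y : ℝ} (ht : t ∈ Ioc 0 T) (hy : y ∈ Ioo 0 Y) :
    ContDiffOn ℝ 2 (fun ξ => w ξ y t) (Ioo (-X) X) :=
  (hw.contDiffOn t ht).comp (f := fun ξ : ℝ => (ξ, y)) (by fun_prop) fun _ hξ => ⟨hξ, hy⟩

theorem IsClassicalSolution.slice_y {σ m X Y T : ℝ} {f : ℝ → ℝ} {w : ℝ → ℝ → ℝ → ℝ}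
    (hw : IsClassicalSolution σ m X Y T f w) {t x : ℝ} (ht : t ∈ Ioc 0 T) (hx : x ∈ Ioo (-X) X) :
    ContDiffOn ℝ 2 (fun η => w x η t) (Ioo 0 Y) :=
  (hw.contDiffOn t ht).comp (f := fun η : ℝ => (x, η)) (by fun_prop) fun _ hη => ⟨hx, hη⟩

theorem IsClassicalSolution.continuousOn_xy {σ m X Y T : ℝ} {f : ℝ → ℝ} {w : ℝ → ℝ → ℝ → ℝ}
    (hw : IsClassicalSolution σ m X Y T f w) {t : ℝ} (ht : t ∈ Icc 0 T) :
    ContinuousOn (fun p : ℝ × ℝ => w p.1 p.2 t) (Icc (-X) X ×ˢ Icc 0 Y) :=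
  hw.continuousOn.comp (f := fun p : ℝ × ℝ => (p.1, p.2, t)) (by fun_prop)
    fun _ hp => ⟨hp.1, hp.2, ht⟩

theorem IsClassicalSolution.continuousOn_y {σ m X Y T : ℝ} {f : ℝ → ℝ} {w : ℝ → ℝ → ℝ → ℝ}
    (hw : IsClassicalSolution σ m X Y T f w) {t x : ℝ} (ht : t ∈ Icc 0 T) (hx : x ∈ Icc (-X) X) :
    ContinuousOn (fun η => w x η t) (Icc 0 Y) :=
  hw.continuousOn.comp (f := fun η : ℝ => (x, η, t)) (by fun_prop) fun _ hη => ⟨hx, hη, ht⟩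

theorem IsClassicalSolution.continuousOn_t {σ m X Y T : ℝ} {f : ℝ → ℝ} {w : ℝ → ℝ → ℝ → ℝ}
    (hw : IsClassicalSolution σ m X Y T f w) {x y : ℝ} (hx : x ∈ Icc (-X) X)
    (hy : y ∈ Icc 0 Y) : ContinuousOn (fun s => w x y s) (Icc 0 T) :=
  hw.continuousOn.comp (f := fun s : ℝ => (x, y, s)) (by fun_prop) fun _ hs => ⟨hx, hy, hs⟩

/-- The lateral condition also holds at the two corners of the base, by continuity. -/
theorem IsClassicalSolution.lateral_eq_zero {σ m X Y T : ℝ} {f : ℝ → ℝ} {w : ℝ → ℝ → ℝ → ℝ}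
    (hw : IsClassicalSolution σ m X Y T f w) (hY : 0 < Y) {t x y : ℝ}
    (ht : t ∈ Icc 0 T) (hx : x ∈ Icc (-X) X) (hy : y ∈ Icc 0 Y)
    (h : x = -X ∨ x = X ∨ y = Y) : w x y t = 0 := by
  rcases hy.1.eq_or_lt with rfl | hy0
  · have hx' : x = -X ∨ x = X := by
      rcases h with h | h | h
      · exact Or.inl h
      · exact Or.inr h
      · exact absurd h hY.ne
    have hc : Tendsto (fun η => w x η t) (𝓝[>] 0) (𝓝 (w x 0 t)) :=
      ((hw.continuousOn_y ht hx) 0 ⟨le_rfl, hY.le⟩).mono_left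
        (nhdsWithin_le_of_mem (Icc_mem_nhdsGT hY))
    refine tendsto_nhds_unique hc (tendsto_const_nhds.congr' ?_)
    filter_upwards [Ioc_mem_nhdsGT hY] with η hη
    exact (hw.lateral_eq t ht x hx η hη (by tauto)).symm
  · exact hw.lateral_eq t ht x hx y ⟨hy0, hy.2⟩ h

/-- In the interior the equation reads `(y^(1-σ) w_y)_y = -y^(1-σ) w_xx`. -/
theorem IsClassicalSolution.deriv_flux {σ m X Y T : ℝ} {f : ℝ → ℝ} {w : ℝ → ℝ → ℝ → ℝ}
    (hw : IsClassicalSolution σ m X Y T f w) {t x y : ℝ} (ht : t ∈ Ioc 0 T)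
    (hx : x ∈ Ioo (-X) X) (hy : y ∈ Ioo 0 Y) :
    HasDerivAt (fun η => η ^ (1 - σ) * deriv (fun η' => w x η' t) η)
      (-(y ^ (1 - σ) * deriv (deriv fun ξ => w ξ y t) x)) y := by
  have hd : DifferentiableAt ℝ (deriv fun η' => w x η' t) y :=
    (((hw.slice_y ht hx).deriv_of_isOpen (m := 1) isOpen_Ioo (by norm_num)).differentiableOn
      (by norm_num)).differentiableAt (isOpen_Ioo.mem_nhds hy)
  have hp : DifferentiableAt ℝ (fun η : ℝ => η ^ (1 - σ)) y :=
    (Real.hasDerivAt_rpow_const (Or.inl hy.1.ne')).differentiableAt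
  have h := (hp.mul hd).hasDerivAt
  have he := hw.interior_eq t ht x hx y hy
  unfold extOp at he
  rw [deriv_const_mul_field] at he
  have he' : deriv (fun η => η ^ (1 - σ) * deriv (fun η' => w x η' t) η) y =
      -(y ^ (1 - σ) * deriv (deriv fun ξ => w ξ y t) x) := by
    linarith
  rw [← he']
  exact h

/-- The maximum principle at a fixed time. -/
theorem IsClassicalSolution.le_of_base_le {σ m X Y T : ℝ} {f : ℝ → ℝ} {w : ℝ → ℝ → ℝ → ℝ}
    (hw : IsClassicalSolution σ m X Y T f w) (hY : 0 < Y) {t B : ℝ}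
    (ht : t ∈ Ioc 0 T) (hB0 : 0 ≤ B) (hB : ∀ x ∈ Icc (-X) X, w x 0 t ≤ B) {x y : ℝ}
    (hx : x ∈ Icc (-X) X) (hy : y ∈ Icc 0 Y) : w x y t ≤ B := by
  have ht' : t ∈ Icc 0 T := ⟨ht.1.le, ht.2⟩
  -- The perturbation `ε x²` makes an interior maximum contradictory: there `w_xx ≤ -2ε`, `w_y = 0`
  -- and `w_yy ≤ 0`, while the equation forces `w_yy = -w_xx`.
  have key : ∀ ε > 0, w x y t ≤ B + ε * X ^ 2 := by
    intro ε hε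
    have hcont : ContinuousOn (fun p : ℝ × ℝ => w p.1 p.2 t + ε * p.1 ^ 2)
        (Icc (-X) X ×ˢ Icc 0 Y) :=
      (hw.continuousOn_xy ht').add (by fun_prop)
    obtain ⟨⟨a, b⟩, ⟨ha, hb⟩, hmax⟩ :=
      (isCompact_Icc.prod isCompact_Icc).exists_isMaxOn ⟨(x, y), hx, hy⟩ hcont
    have hsq : ∀ z ∈ Icc (-X) X, z ^ 2 ≤ X ^ 2 := fun z hz => sq_le_sq' hz.1 hz.2
    have hle : w x y t + ε * x ^ 2 ≤ w a b t + ε * a ^ 2 :=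
      hmax (show (x, y) ∈ Icc (-X) X ×ˢ Icc 0 Y from ⟨hx, hy⟩)
    have hasq := mul_le_mul_of_nonneg_left (hsq a ha) hε.le
    suffices hab : w a b t ≤ B by
      have := mul_nonneg hε.le (sq_nonneg x)
      linarith
    simp only at ha hb
    by_cases hbd : a = -X ∨ a = X ∨ b = Y
    · rw [hw.lateral_eq_zero hY ht' ha hb hbd]
      exact hB0
    push Not at hbd
    rcases hb.1.eq_or_lt with rfl | hb0
    · exact hB a ha
    exfalso
    have ha' : a ∈ Ioo (-X) X := ⟨lt_of_le_of_ne ha.1 (Ne.symm hbd.1), lt_of_le_of_ne ha.2 hbd.2.1⟩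
    have hb' : b ∈ Ioo 0 Y := ⟨hb0, lt_of_le_of_ne hb.2 hbd.2.2⟩
    have hdx : ContDiffAt ℝ 2 (fun ξ => w ξ b t) a :=
      (hw.slice_x ht hb').contDiffAt (isOpen_Ioo.mem_nhds ha')
    have hlx : IsLocalMax (fun ξ => w ξ b t + ε * ξ ^ 2) a := by
      filter_upwards [isOpen_Ioo.mem_nhds ha'] with ξ hξ
      exact hmax (show (ξ, b) ∈ Icc (-X) X ×ˢ Icc 0 Y from ⟨Ioo_subset_Icc_self hξ, hb⟩)
    have hxx := deriv_deriv_nonpos_of_isLocalMax hlx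
      (hdx.continuousAt.add (by fun_prop))
    have hev : deriv (fun ξ => w ξ b t + ε * ξ ^ 2) =ᶠ[𝓝 a]
        fun ξ => deriv (fun ξ => w ξ b t) ξ + ε * (2 * ξ) := by
      filter_upwards [isOpen_Ioo.mem_nhds ha'] with ξ hξ
      have h₁ : DifferentiableAt ℝ (fun ξ => w ξ b t) ξ :=
        ((hw.slice_x ht hb').contDiffAt (isOpen_Ioo.mem_nhds hξ)).differentiableAt (by norm_num)
      have h₂ : HasDerivAt (fun ξ => w ξ b t + ε * ξ ^ 2) _ ξ :=
        h₁.hasDerivAt.add ((hasDerivAt_pow 2 ξ).const_mul ε)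
      simpa using h₂.deriv
    have hddx : DifferentiableAt ℝ (deriv fun ξ => w ξ b t) a :=
      (((hw.slice_x ht hb').deriv_of_isOpen (m := 1) isOpen_Ioo (by norm_num)).differentiableOn
        (by norm_num)).differentiableAt (isOpen_Ioo.mem_nhds ha')
    have hdd : HasDerivAt (fun ξ => deriv (fun ξ => w ξ b t) ξ + ε * (2 * ξ)) _ a :=
      hddx.hasDerivAt.add (((hasDerivAt_id a).const_mul 2).const_mul ε)
    rw [hev.deriv_eq, hdd.deriv] at hxx
    have hdy : ContDiffAt ℝ 2 (fun η => w a η t) b :=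
      (hw.slice_y ht ha').contDiffAt (isOpen_Ioo.mem_nhds hb')
    have hly : IsLocalMax (fun η => w a η t) b := by
      filter_upwards [isOpen_Ioo.mem_nhds hb'] with η hη
      have := hmax (show (a, η) ∈ Icc (-X) X ×ˢ Icc 0 Y from ⟨ha, Ioo_subset_Icc_self hη⟩)
      simpa using this
    have hyy := deriv_deriv_nonpos_of_isLocalMax hly hdy.continuousAt
    have hddy : DifferentiableAt ℝ (deriv fun η => w a η t) b :=
      (((hw.slice_y ht ha').deriv_of_isOpen (m := 1) isOpen_Ioo (by norm_num)).differentiableOn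
        (by norm_num)).differentiableAt (isOpen_Ioo.mem_nhds hb')
    have hprod := (Real.hasDerivAt_rpow_const (p := 1 - σ) (Or.inl hb0.ne')).mul hddy.hasDerivAt
    have huniq := hprod.unique (hw.deriv_flux ht ha' hb')
    rw [hly.deriv_eq_zero] at huniq
    have hbpos : 0 < b ^ (1 - σ) := Real.rpow_pos_of_pos hb0 _
    nlinarith
  have hlim : Tendsto (fun ε : ℝ => B + ε * X ^ 2) (𝓝[>] 0) (𝓝 B) := by
    have : Tendsto (fun ε : ℝ => B + ε * X ^ 2) (𝓝 0) (𝓝 (B + 0 * X ^ 2)) :=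
      (Continuous.tendsto (by fun_prop) 0)
    simpa using this.mono_left nhdsWithin_le_nhds
  exact ge_of_tendsto hlim (eventually_mem_nhdsWithin.mono fun ε hε => key ε hε)

/-- No bound on `f` is assumed; it comes from the continuity of `w` at `t = 0` on a compact
interval, and makes `supNorm` a genuine supremum. -/
theorem IsClassicalSolution.bddAbove_image {σ m X Y T : ℝ} {f : ℝ → ℝ} {w : ℝ → ℝ → ℝ → ℝ}
    (hw : IsClassicalSolution σ m X Y T f w) (hm : 1 ≤ m) (hY : 0 < Y) (hT : 0 < T)
    (hf : ∀ x ∈ Icc (-X) X, 0 ≤ f x) : BddAbove (f '' Icc (-X) X) := by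
  have hc : ContinuousOn (fun x => w x 0 0) (Icc (-X) X) :=
    hw.continuousOn.comp (f := fun x : ℝ => (x, (0 : ℝ), (0 : ℝ))) (by fun_prop)
      fun _ hx => ⟨hx, ⟨le_rfl, hY.le⟩, ⟨le_rfl, hT.le⟩⟩
  obtain ⟨B, hB⟩ := isCompact_Icc.bddAbove_image hc
  refine ⟨B ^ (1 / m), ?_⟩
  rintro _ ⟨x, hx, rfl⟩
  have h : f x ^ m ≤ B := by
    rw [← hw.initial_eq x hx]
    exact hB ⟨x, hx, rfl⟩
  have h' := Real.rpow_le_rpow (Real.rpow_nonneg (hf x hx) m) h (by positivity : 0 ≤ 1 / m)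
  rwa [← Real.rpow_mul (hf x hx), mul_one_div_cancel (by positivity), Real.rpow_one] at h'

/-- The solution `u = w^(1/m)` on the base does not exceed its initial maximum. -/
theorem IsClassicalSolution.base_le_supNorm {σ m X Y T : ℝ} {f : ℝ → ℝ} {w : ℝ → ℝ → ℝ → ℝ}
    (hw : IsClassicalSolution σ m X Y T f w) (hσ0 : 0 < σ) (hσ2 : σ < 2) (hm : 1 ≤ m)
    (hY : 0 < Y) (hT : 0 < T) (hf : ∀ x ∈ Icc (-X) X, 0 ≤ f x)
    {x t : ℝ} (hx : x ∈ Icc (-X) X) (ht : t ∈ Icc 0 T) :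
    w x 0 t ^ (1 / m) ≤ supNorm X f := by
  have hm0 : 0 < m := by linarith
  have h0Y : (0 : ℝ) ∈ Icc 0 Y := ⟨le_rfl, hY.le⟩
  -- If `u - ε t` is maximal on the base at a positive time, then `u_t ≥ ε` there. By the boundary
  -- condition `w` then increases strictly off the base, although the point is also a maximum of `w`
  -- on the base at that time.
  have key : ∀ ε > 0, w x 0 t ^ (1 / m) ≤ supNorm X f + ε * T := by
    intro ε hε
    have hcw : ContinuousOn (fun p : ℝ × ℝ => w p.1 0 p.2) (Icc (-X) X ×ˢ Icc 0 T) :=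
      hw.continuousOn.comp (f := fun p : ℝ × ℝ => (p.1, (0 : ℝ), p.2)) (by fun_prop)
        fun _ hp => ⟨hp.1, h0Y, hp.2⟩
    have hcont : ContinuousOn (fun p : ℝ × ℝ => w p.1 0 p.2 ^ (1 / m) - ε * p.2)
        (Icc (-X) X ×ˢ Icc 0 T) :=
      (hcw.rpow_const fun _ _ => Or.inr (by positivity)).sub (by fun_prop)
    obtain ⟨⟨a, s⟩, ⟨ha, hs⟩, hmax⟩ :=
      (isCompact_Icc.prod isCompact_Icc).exists_isMaxOn ⟨(x, t), hx, ht⟩ hcont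
    simp only at ha hs
    have hle : w x 0 t ^ (1 / m) - ε * t ≤ w a 0 s ^ (1 / m) - ε * s :=
      hmax (show (x, t) ∈ Icc (-X) X ×ˢ Icc 0 T from ⟨hx, ht⟩)
    rcases hs.1.eq_or_lt with rfl | hs0
    · rw [hw.initial_eq a ha, ← Real.rpow_mul (hf a ha), mul_one_div_cancel hm0.ne',
        Real.rpow_one] at hle
      have h₁ : f a ≤ supNorm X f := le_csSup (hw.bddAbove_image hm hY hT hf) ⟨a, ha, rfl⟩
      have h₂ := mul_le_mul_of_nonneg_left ht.2 hε.le
      linarith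
    exfalso
    have hs' : s ∈ Ioc 0 T := ⟨hs0, hs.2⟩
    obtain ⟨q, hq, hσq⟩ := hw.base_eq s hs' a ha
    -- Only difference quotients from the left are used, so the final time is covered too.
    have hqε : ε ≤ q := by
      have h₁ : HasDerivWithinAt (fun s => w a 0 s ^ (1 / m)) q (Ioo 0 s) s :=
        hq.mono fun r hr => ⟨hr.1, hr.2.le.trans hs.2⟩
      rw [hasDerivWithinAt_iff_tendsto_slope' (by simp)] at h₁
      have : (𝓝[Ioo 0 s] s).NeBot := by
        rw [nhdsWithin_Ioo_eq_nhdsLT hs0]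
        infer_instance
      refine ge_of_tendsto h₁ ?_
      filter_upwards [self_mem_nhdsWithin] with r hr
      have h₂ : w a 0 r ^ (1 / m) - ε * r ≤ w a 0 s ^ (1 / m) - ε * s :=
        hmax (show (a, r) ∈ Icc (-X) X ×ˢ Icc 0 T from ⟨ha, hr.1.le, hr.2.le.trans hs.2⟩)
      rw [slope_def_field, le_div_iff_of_neg (by linarith [hr.2])]
      linarith
    have hqpos : 0 < q := hε.trans_le hqε
    have hev : ∀ᶠ y in 𝓝[>] (0 : ℝ), 0 < deriv (fun η => w a η s) y := by
      filter_upwards [hσq.eventually (lt_mem_nhds hqpos), self_mem_nhdsWithin] with y hy hy0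
      have h₁ : 0 < mu σ * y ^ (1 - σ) := mul_pos (mu_pos hσ0 hσ2) (Real.rpow_pos_of_pos hy0 _)
      rw [← mul_assoc] at hy
      exact pos_of_mul_pos_right hy h₁.le
    obtain ⟨δ, hδ0, hδ⟩ := (mem_nhdsGT_iff_exists_Ioo_subset' (show (0 : ℝ) < Y from hY)).1 hev
    set d := min δ Y with hd
    have hd0 : 0 < d := lt_min hδ0 hY
    have hmono : StrictMonoOn (fun η => w a η s) (Icc 0 d) := by
      refine strictMonoOn_of_deriv_pos (convex_Icc _ _)
        ((hw.continuousOn_y hs ha).mono (Icc_subset_Icc_right (min_le_right _ _))) ?_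
      rw [interior_Icc]
      exact fun y hy => hδ ⟨hy.1, hy.2.trans_le (min_le_left _ _)⟩
    have h₁ : w a 0 s < w a d s := hmono ⟨le_rfl, hd0.le⟩ ⟨hd0.le, le_rfl⟩ hd0
    refine h₁.not_ge (hw.le_of_base_le hY hs' (hw.nonneg a ha 0 h0Y s hs) ?_ ha
      ⟨hd0.le, min_le_right _ _⟩)
    intro z hz
    have h₂ : w z 0 s ^ (1 / m) - ε * s ≤ w a 0 s ^ (1 / m) - ε * s :=
      hmax (show (z, s) ∈ Icc (-X) X ×ˢ Icc 0 T from ⟨hz, hs⟩)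
    exact (Real.rpow_le_rpow_iff (hw.nonneg z hz 0 h0Y s hs) (hw.nonneg a ha 0 h0Y s hs)
      (by positivity : 0 < 1 / m)).1 (by linarith)
  have hlim : Tendsto (fun ε : ℝ => supNorm X f + ε * T) (𝓝[>] 0) (𝓝 (supNorm X f)) := by
    have : Tendsto (fun ε : ℝ => supNorm X f + ε * T) (𝓝 0) (𝓝 (supNorm X f + 0 * T)) :=
      (Continuous.tendsto (by fun_prop) 0)
    simpa using this.mono_left nhdsWithin_le_nhds
  exact ge_of_tendsto hlim (eventually_mem_nhdsWithin.mono fun ε hε => key ε hε)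


/-! ### Behaviour at the base: expansion, growth and consistency -/

/-- A lower bound near `y = 0` for a function whose weighted derivative `y^(1-σ) g'` has the
limit `κ` at `0` and a derivative bounded below by `-M y^(1-σ)`. -/
theorem sigma_expansion_lower {g : ℝ → ℝ} {σ Y M κ : ℝ} (hσ0 : 0 < σ) (hσ2 : σ < 2)
    (hc : ContinuousOn g (Icc 0 Y)) (hd : DifferentiableOn ℝ g (Ioo 0 Y))
    (hflux : ∀ y ∈ Ioo 0 Y, ∃ d, HasDerivAt (fun η => η ^ (1 - σ) * deriv g η) d y ∧
      -(M * y ^ (1 - σ)) ≤ d)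
    (hlim : Tendsto (fun η => η ^ (1 - σ) * deriv g η) (𝓝[>] 0) (𝓝 κ)) {y : ℝ}
    (hy : y ∈ Icc 0 Y) : κ / σ * y ^ σ - M / (2 * (2 - σ)) * y ^ 2 ≤ g y - g 0 := by
  have h2σ : 0 < 2 - σ := by linarith
  -- The correction cancels the worst decrease of the flux, so `H` is monotone and stays above its
  -- limit `κ`.
  set H : ℝ → ℝ := fun η => η ^ (1 - σ) * deriv g η + M / (2 - σ) * η ^ (2 - σ) with hH
  have hHd : ∀ z ∈ Ioo 0 Y, ∃ d, HasDerivAt H d z ∧ 0 ≤ d := by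
    intro z hz
    obtain ⟨d, hd, hdle⟩ := hflux z hz
    refine ⟨_, hd.add ((Real.hasDerivAt_rpow_const (p := 2 - σ)
      (Or.inl hz.1.ne')).const_mul (M / (2 - σ))), ?_⟩
    have h₁ : M / (2 - σ) * ((2 - σ) * z ^ (2 - σ - 1)) = M * z ^ (1 - σ) := by
      rw [show 2 - σ - 1 = 1 - σ by ring]
      field_simp
    rw [h₁]
    linarith
  have hHmono : MonotoneOn H (Ioo 0 Y) := by
    refine monotoneOn_of_deriv_nonneg (convex_Ioo _ _) ?_ ?_ ?_
    · intro z hz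
      obtain ⟨d, hd, -⟩ := hHd z hz
      exact hd.continuousAt.continuousWithinAt
    · rw [interior_Ioo]
      intro z hz
      obtain ⟨d, hd, -⟩ := hHd z hz
      exact hd.differentiableAt.differentiableWithinAt
    · rw [interior_Ioo]
      intro z hz
      obtain ⟨d, hd, hd0⟩ := hHd z hz
      rwa [hd.deriv]
  have hHlim : Tendsto H (𝓝[>] 0) (𝓝 κ) := by
    have h₁ : Tendsto (fun η : ℝ => M / (2 - σ) * η ^ (2 - σ)) (𝓝 0)
        (𝓝 (M / (2 - σ) * (0 : ℝ) ^ (2 - σ))) :=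
      ((Real.continuous_rpow_const h2σ.le).const_mul _).tendsto 0
    rw [Real.zero_rpow h2σ.ne', mul_zero] at h₁
    simpa using hlim.add (h₁.mono_left nhdsWithin_le_nhds)
  have hκ : ∀ z ∈ Ioo 0 Y, κ ≤ H z := by
    intro z hz
    refine le_of_tendsto hHlim ?_
    filter_upwards [Ioo_mem_nhdsGT hz.1] with η hη
    exact hHmono ⟨hη.1, hη.2.trans hz.2⟩ hz hη.2.le
  -- `G' = z^(σ-1) (H - κ) ≥ 0`, and the claim is `G 0 ≤ G y`.
  set G : ℝ → ℝ := fun η => g η - κ / σ * η ^ σ + M / (2 * (2 - σ)) * η ^ 2 with hG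
  have hGd : ∀ z ∈ Ioo 0 Y, ∃ d, HasDerivAt G d z ∧ 0 ≤ d := by
    intro z hz
    have hg : HasDerivAt g (deriv g z) z :=
      (hd.differentiableAt (isOpen_Ioo.mem_nhds hz)).hasDerivAt
    refine ⟨_, (hg.sub ((Real.hasDerivAt_rpow_const (p := σ)
      (Or.inl hz.1.ne')).const_mul (κ / σ))).add
      ((hasDerivAt_pow 2 z).const_mul (M / (2 * (2 - σ)))), ?_⟩
    have hz0 := hz.1
    have e₁ : z ^ (σ - 1) * z ^ (1 - σ) = 1 := by
      rw [← Real.rpow_add hz0]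
      simp
    have e₂ : z ^ (σ - 1) * z ^ (2 - σ) = z := by
      rw [← Real.rpow_add hz0]
      norm_num
    have h₁ := mul_nonneg (Real.rpow_nonneg hz0.le (σ - 1)) (sub_nonneg.2 (hκ z hz))
    have h₂ : z ^ (σ - 1) * (H z - κ) = deriv g z - κ / σ * (σ * z ^ (σ - 1)) +
        M / (2 * (2 - σ)) * ((2 : ℕ) * z ^ (2 - 1)) := by
      simp only [hH]
      have e₃ : κ / σ * (σ * z ^ (σ - 1)) = κ * z ^ (σ - 1) := by field_simp
      have e₄ : M / (2 * (2 - σ)) * (((2 : ℕ) : ℝ) * z ^ (2 - 1)) = M / (2 - σ) * z := by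
        push_cast
        field_simp
      rw [e₃, e₄]
      linear_combination deriv g z * e₁ + M / (2 - σ) * e₂
    linarith
  have hGmono : MonotoneOn G (Icc 0 Y) := by
    refine monotoneOn_of_deriv_nonneg (convex_Icc _ _) ?_ ?_ ?_
    · exact (hc.sub ((Real.continuous_rpow_const hσ0.le).const_mul _).continuousOn).add
        (by fun_prop)
    · rw [interior_Icc]
      intro z hz
      obtain ⟨d, hd, -⟩ := hGd z hz
      exact hd.differentiableAt.differentiableWithinAt
    · rw [interior_Icc]
      intro z hz
      obtain ⟨d, hd, hd0⟩ := hGd z hz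
      rwa [hd.deriv]
  have := hGmono ⟨le_rfl, hy.1.trans hy.2⟩ hy hy.1
  simp only [hG, Real.zero_rpow hσ0.ne'] at this
  linarith

/-- The expansion `w = w(x, 0) + (q / ν_σ) y^σ + O(y²)` at the base. -/
theorem IsClassicalSolution.sigma_expansion {σ m X Y T : ℝ} {f : ℝ → ℝ} {w : ℝ → ℝ → ℝ → ℝ}
    (hw : IsClassicalSolution σ m X Y T f w) (hσ0 : 0 < σ) (hσ2 : σ < 2) {t x q Mx : ℝ}
    (ht : t ∈ Ioc 0 T) (hx : x ∈ Ioo (-X) X)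
    (hM : ∀ y ∈ Ioo 0 Y, |iteratedDeriv 2 (fun ξ => w ξ y t) x| ≤ Mx)
    (hq : HasSigmaDeriv σ (fun x y => w x y t) x q) {y : ℝ} (hy : y ∈ Icc 0 Y) :
    |w x y t - w x 0 t - q / nu σ * y ^ σ| ≤ Mx / (2 * (2 - σ)) * y ^ 2 := by
  have hμ := mu_pos hσ0 hσ2
  have hc := hw.continuousOn_y ⟨ht.1.le, ht.2⟩ (Ioo_subset_Icc_self hx)
  have hd : DifferentiableOn ℝ (fun η => w x η t) (Ioo 0 Y) :=
    (hw.slice_y ht hx).differentiableOn (by norm_num)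
  have hlim : Tendsto (fun η => η ^ (1 - σ) * deriv (fun η' => w x η' t) η) (𝓝[>] 0)
      (𝓝 (q / mu σ)) := by
    have h := Tendsto.div_const hq (mu σ)
    refine h.congr fun y => ?_
    field_simp
  have hM' : ∀ y ∈ Ioo 0 Y, |y ^ (1 - σ) * deriv (deriv fun ξ => w ξ y t) x| ≤
      Mx * y ^ (1 - σ) := by
    intro z hz
    have h := hM z hz
    rw [iteratedDeriv_succ, iteratedDeriv_one] at h
    have hp := Real.rpow_nonneg hz.1.le (1 - σ)
    rw [abs_mul, abs_of_nonneg hp, mul_comm]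
    exact mul_le_mul_of_nonneg_right h hp
  have hlow := sigma_expansion_lower (M := Mx) hσ0 hσ2 hc hd (fun z hz =>
    ⟨_, hw.deriv_flux ht hx hz, neg_le_neg (le_of_abs_le (hM' z hz))⟩) hlim hy
  -- The upper bound is the lower bound for `-w`, whose flux tends to `-q / μ_σ`.
  have hup := sigma_expansion_lower (g := fun η => -w x η t) (M := Mx) (κ := -(q / mu σ))
    hσ0 hσ2 hc.neg hd.neg (fun z hz => by
      refine ⟨_, ?_, neg_le_of_abs_le (hM' z hz)⟩
      have h := (hw.deriv_flux ht hx hz).neg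
      rw [neg_neg] at h
      refine h.congr_of_eventuallyEq (Eventually.of_forall fun η => ?_)
      simp) (by simpa using hlim.neg) hy
  have hκ : q / nu σ = q / mu σ / σ := by
    unfold nu
    field_simp
  rw [hκ, abs_le]
  rw [neg_div, neg_mul] at hup
  constructor <;> linarith

/-- Since `q = u_t`, this is the differential inequality `u_t ≤ A u`. Let `a = w(x, 0)` and `b =
w(x, y)`. If `q > 0`, the expansion makes `b - a` at least about `(q / ν_σ) y^σ`. Bernoulli's
inequality gives `(m - 1)(b - a) ≤ (φ'(u_b) - φ'(u_a)) b^(1/m)`, and the regularity of `φ'(u)`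
bounds the right side by `|K| y^σ b^(1/m)`. Dividing by `y^σ` and letting `y → 0` gives the claim,
also where `u = 0`. -/
theorem IsRegular.sigmaDeriv_le {σ m X Y T : ℝ} {f : ℝ → ℝ} {w : ℝ → ℝ → ℝ → ℝ}
    (hreg : IsRegular σ m X Y T w) (hw : IsClassicalSolution σ m X Y T f w)
    (hσ0 : 0 < σ) (hσ2 : σ < 2) (hm : 1 < m) (hY : 0 < Y) :
    ∃ A : ℝ, 0 ≤ A ∧ ∀ t ∈ Ioc 0 T, ∀ x ∈ Ioo (-X) X, ∀ q : ℝ,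
      HasSigmaDeriv σ (fun x y => w x y t) x q → q ≤ A * w x 0 t ^ (1 / m) := by
  obtain ⟨Mx, hMx⟩ := hreg.xx
  obtain ⟨K, hK⟩ := hreg.slope
  have hν := nu_pos hσ0 hσ2
  have hm0 : 0 < m := by linarith
  refine ⟨|K| * nu σ / (m - 1), by have : 0 < m - 1 := by linarith
                                   positivity, ?_⟩
  intro t ht x hx q hq
  have htI : t ∈ Icc 0 T := ⟨ht.1.le, ht.2⟩
  have hxI := Ioo_subset_Icc_self hx
  have hu0 : 0 ≤ w x 0 t ^ (1 / m) :=
    Real.rpow_nonneg (hw.nonneg x hxI 0 ⟨le_rfl, hY.le⟩ t htI) _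
  rcases le_or_gt q 0 with hq0 | hq0
  · have : 0 < m - 1 := by linarith
    exact hq0.trans (by positivity)
  set κ := (m - 1) / m with hκ
  have hκ0 : 0 ≤ κ := div_nonneg (by linarith) hm0.le
  have hκ1 : κ ≤ 1 := (div_le_one hm0).2 (by linarith)
  set c := Mx / (2 * (2 - σ)) with hc
  have hlimc : Tendsto (fun y : ℝ => q / nu σ - c * y ^ (2 - σ)) (𝓝[>] 0) (𝓝 (q / nu σ)) := by
    have h₁ : Tendsto (fun y : ℝ => q / nu σ - c * y ^ (2 - σ)) (𝓝 0)
        (𝓝 (q / nu σ - c * (0 : ℝ) ^ (2 - σ))) :=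
      (continuous_const.sub ((Real.continuous_rpow_const (by linarith)).const_mul c)).tendsto 0
    rw [Real.zero_rpow (by linarith), mul_zero, sub_zero] at h₁
    exact h₁.mono_left nhdsWithin_le_nhds
  have hev : ∀ᶠ y in 𝓝[>] (0 : ℝ),
      (m - 1) * (q / nu σ - c * y ^ (2 - σ)) ≤ |K| * w x y t ^ (1 / m) := by
    filter_upwards [hlimc.eventually (lt_mem_nhds (div_pos hq0 hν)), Ioo_mem_nhdsGT hY]
      with y hpos hy
    have hyI := Ioo_subset_Icc_self hy
    have hy0 := hy.1
    have hyσ : 0 < y ^ σ := Real.rpow_pos_of_pos hy0 σ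
    have hexp := hw.sigma_expansion hσ0 hσ2 ht hx (fun z hz => hMx t ht x hx z hz) hq hyI
    have h2 : y ^ (2 - σ) * y ^ σ = y ^ 2 := by
      rw [← Real.rpow_add hy0]
      norm_num
    have hinc : (q / nu σ - c * y ^ (2 - σ)) * y ^ σ ≤ w x y t - w x 0 t := by
      have := neg_le_of_abs_le hexp
      rw [sub_mul, mul_assoc, h2]
      linarith
    have ha0 := hw.nonneg x hxI 0 ⟨le_rfl, hY.le⟩ t htI
    have hb0 : 0 < w x y t := by
      have := mul_pos hpos hyσ
      linarith
    set a := w x 0 t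
    set b := w x y t
    have hslope := hK t ht x hxI y hyI
    have hpw : ∀ z : ℝ, 0 ≤ z → (z ^ (1 / m)) ^ (m - 1) = z ^ κ := fun z hz => by
      rw [← Real.rpow_mul hz, hκ]
      ring_nf
    rw [hpw a ha0, hpw b hb0.le] at hslope
    have hbern : (a / b) ^ κ ≤ 1 + κ * (a / b - 1) := by
      have := rpow_one_add_le_one_add_mul_self (s := a / b - 1)
        (by have := div_nonneg ha0 hb0.le; linarith) hκ0 hκ1
      simpa using this
    rw [Real.div_rpow ha0 hb0.le, div_le_iff₀ (Real.rpow_pos_of_pos hb0 κ)] at hbern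
    have hbκ : b ^ κ * b ^ (1 / m) = b := by
      rw [← Real.rpow_add hb0, hκ, ← add_div, sub_add_cancel, div_self hm0.ne', Real.rpow_one]
    have hb1 : 0 < b ^ (1 / m) := Real.rpow_pos_of_pos hb0 _
    have hmκ : m * κ = m - 1 := by
      rw [hκ]
      field_simp
    have h₁ : (m - 1) * (b - a) ≤ (m * b ^ κ - m * a ^ κ) * b ^ (1 / m) := by
      have h₂ : m * a ^ κ * b ^ (1 / m) ≤
          m * ((1 + κ * (a / b - 1)) * b ^ κ) * b ^ (1 / m) := by gcongr
      have h₃ : m * ((1 + κ * (a / b - 1)) * b ^ κ) * b ^ (1 / m) =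
          m * b + (m - 1) * (a - b) := by
        calc m * ((1 + κ * (a / b - 1)) * b ^ κ) * b ^ (1 / m)
            = (m + m * κ * (a / b - 1)) * (b ^ κ * b ^ (1 / m)) := by ring
          _ = (m + (m - 1) * (a / b - 1)) * b := by rw [hbκ, hmκ]
          _ = m * b + (m - 1) * (a - b) := by field_simp
      have h₄ : m * b ^ κ * b ^ (1 / m) = m * b := by rw [mul_assoc, hbκ]
      linarith [sub_mul (m * b ^ κ) (m * a ^ κ) (b ^ (1 / m))]
    have h₅ : (m * b ^ κ - m * a ^ κ) * b ^ (1 / m) ≤ |K| * y ^ σ * b ^ (1 / m) := by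
      refine mul_le_mul_of_nonneg_right ((le_abs_self _).trans (hslope.trans ?_)) hb1.le
      exact mul_le_mul_of_nonneg_right (le_abs_self K) hyσ.le
    have h₆ := mul_le_mul_of_nonneg_left hinc (by linarith : 0 ≤ m - 1)
    refine le_of_mul_le_mul_right ?_ hyσ
    linarith
  have hcw : Tendsto (fun y => |K| * w x y t ^ (1 / m)) (𝓝[>] 0)
      (𝓝 (|K| * w x 0 t ^ (1 / m))) := by
    have h₁ : Tendsto (fun η => w x η t) (𝓝[>] 0) (𝓝 (w x 0 t)) :=
      ((hw.continuousOn_y htI hxI) 0 ⟨le_rfl, hY.le⟩).mono_left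
        (nhdsWithin_le_of_mem (Icc_mem_nhdsGT hY))
    exact (h₁.rpow_const (Or.inr (by positivity))).const_mul _
  have hfin := le_of_tendsto_of_tendsto (hlimc.const_mul (m - 1)) hcw hev
  have hm1 : 0 < m - 1 := by linarith
  rw [← mul_div_assoc, div_le_iff₀ hν] at hfin
  rw [div_mul_eq_mul_div, le_div_iff₀ hm1]
  linarith

/-- Exponential growth of the solution on the base; nothing is claimed in the linear case. -/
theorem IsRegular.exists_growth {σ m X Y T : ℝ} {f : ℝ → ℝ} {w : ℝ → ℝ → ℝ → ℝ}
    (hreg : IsRegular σ m X Y T w) (hw : IsClassicalSolution σ m X Y T f w)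
    (hσ0 : 0 < σ) (hσ2 : σ < 2) (hm : 1 ≤ m) (hY : 0 < Y) :
    ∃ A : ℝ, 0 ≤ A ∧ ∀ x ∈ Ioo (-X) X, ∀ s t : ℝ, 0 ≤ s → s < t → t ≤ T →
      (m = 1 ∨ w x 0 t ^ (1 / m) ≤ Real.exp (A * (t - s)) * w x 0 s ^ (1 / m)) := by
  rcases hm.eq_or_lt with rfl | hm1
  · exact ⟨0, le_rfl, fun _ _ _ _ _ _ _ => Or.inl rfl⟩
  obtain ⟨A, hA0, hA⟩ := hreg.sigmaDeriv_le hw hσ0 hσ2 hm1 hY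
  refine ⟨A, hA0, fun x hx s t hs hst htT => Or.inr ?_⟩
  have hxI := Ioo_subset_Icc_self hx
  have hcu : ContinuousOn (fun r => w x 0 r ^ (1 / m)) (Icc 0 T) :=
    (hw.continuousOn_t hxI ⟨le_rfl, hY.le⟩).rpow_const fun _ _ => Or.inr (by positivity)
  have hsub : Icc s t ⊆ Icc 0 T := Icc_subset_Icc hs htT
  -- Gronwall's argument: `e^(-A r) u(r)` is nonincreasing. Continuity on the closed interval admits
  -- `s = 0`.
  have hder : ∀ r ∈ Ioo s t, ∃ d, HasDerivAt
      (fun r => Real.exp (-A * r) * w x 0 r ^ (1 / m)) d r ∧ d ≤ 0 := by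
    intro r hr
    have hr' : r ∈ Ioc 0 T := ⟨hs.trans_lt hr.1, hr.2.le.trans htT⟩
    obtain ⟨q, hq, hσq⟩ := hw.base_eq r hr' x hxI
    have h₁ : HasDerivAt (fun s => w x 0 s ^ (1 / m)) q r :=
      hq.hasDerivAt (Ioc_mem_nhds hr'.1 (hr.2.trans_le htT))
    refine ⟨_, (((hasDerivAt_id r).const_mul (-A)).exp).mul h₁, ?_⟩
    have h₂ := hA r hr' x hx q hσq
    have h₃ := Real.exp_pos (-A * id r)
    nlinarith
  have hanti : AntitoneOn (fun r => Real.exp (-A * r) * w x 0 r ^ (1 / m)) (Icc s t) := by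
    refine antitoneOn_of_deriv_nonpos (convex_Icc _ _) ?_ ?_ ?_
    · exact ContinuousOn.mul (by fun_prop) (hcu.mono hsub)
    · rw [interior_Icc]
      intro z hz
      obtain ⟨d, hd, -⟩ := hder z hz
      exact hd.differentiableAt.differentiableWithinAt
    · rw [interior_Icc]
      intro z hz
      obtain ⟨d, hd, hd0⟩ := hder z hz
      rwa [hd.deriv]
  have h := hanti ⟨le_rfl, hst.le⟩ ⟨hst.le, le_rfl⟩ hst.le
  have h' := mul_le_mul_of_nonneg_left h (Real.exp_pos (A * t)).le
  simp only [← mul_assoc, ← Real.exp_add] at h'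
  rw [show A * t + -A * t = 0 by ring, Real.exp_zero, one_mul] at h'
  rwa [show A * (t - s) = A * t + -A * s by ring]

/-- The truncation error of the explicit scheme on the base. -/
theorem IsRegular.exists_consistency {σ m X Y T : ℝ} {f : ℝ → ℝ} {w : ℝ → ℝ → ℝ → ℝ}
    (hreg : IsRegular σ m X Y T w) (hw : IsClassicalSolution σ m X Y T f w)
    (hσ0 : 0 < σ) (hσ2 : σ < 2) (hm : 1 ≤ m) (hY : 0 < Y) :
    ∃ C : ℝ, 0 ≤ C ∧ ∀ x ∈ Ioo (-X) X, ∀ s t h : ℝ, 0 ≤ s → s < t → t ≤ T → 0 < h → h ≤ Y →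
      |w x 0 t ^ (1 / m) - w x 0 s ^ (1 / m) -
        nu σ * ((t - s) / h ^ σ) * (w x h s - w x 0 s)| ≤
        C * ((t - s) ^ 2 + (t - s) * h ^ (2 - σ)) := by
  obtain ⟨Mx, hMx⟩ := hreg.xx
  obtain ⟨Mt, hMt⟩ := hreg.tt
  have hν := nu_pos hσ0 hσ2
  have h2σ : 0 < 2 - σ := by linarith
  set c := Mx / (2 * (2 - σ)) with hc
  refine ⟨|Mt| + nu σ * |c|, by positivity, ?_⟩
  intro x hx s₀ t h hs₀ hst₀ htT hh hhY
  have hxI := Ioo_subset_Icc_self hx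
  have ht0 : 0 < t := hs₀.trans_lt hst₀
  have hcw : ∀ y ∈ Icc 0 Y, ContinuousOn (fun r => w x y r) (Icc 0 t) := fun y hy =>
    (hw.continuousOn_t hxI hy).mono (Icc_subset_Icc_right htT)
  have h0Y : (0 : ℝ) ∈ Icc 0 Y := ⟨le_rfl, hY.le⟩
  have hcu : ContinuousOn (fun r => w x 0 r ^ (1 / m)) (Icc 0 t) :=
    (hcw 0 h0Y).rpow_const fun _ _ => Or.inr (by positivity)
  have hclos : closure (Ioo 0 t) = Icc 0 t := closure_Ioo ht0.ne
  -- The equation and the regularity hold only at positive times; both sides are continuous in `s`,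
  -- so the estimate extends to `s = 0`, the first step of the scheme.
  refine le_on_closure (s := Ioo 0 t)
    (f := fun s => |w x 0 t ^ (1 / m) - w x 0 s ^ (1 / m) -
        nu σ * ((t - s) / h ^ σ) * (w x h s - w x 0 s)|)
    (g := fun s => (|Mt| + nu σ * |c|) * ((t - s) ^ 2 + (t - s) * h ^ (2 - σ)))
    ?_ ?_ ?_ (show s₀ ∈ closure (Ioo 0 t) by rw [hclos]; exact ⟨hs₀, hst₀.le⟩)
  · intro s hs
    have hs' : s ∈ Ioc 0 T := ⟨hs.1, hs.2.le.trans htT⟩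
    have ht' : t ∈ Ioc 0 T := ⟨ht0, htT⟩
    obtain ⟨q, hq, hσq⟩ := hw.base_eq s hs' x hxI
    have hspace := hw.sigma_expansion hσ0 hσ2 hs' hx (fun z hz => hMx s hs' x hx z hz) hσq
      ⟨hh.le, hhY⟩
    obtain ⟨hcd, hbd⟩ := hMt x hxI
    set u : ℝ → ℝ := fun r => w x 0 r ^ (1 / m) with hu
    have hud := uniqueDiffOn_Ioc 0 T
    have hdu : DifferentiableOn ℝ u (Ioc 0 T) := hcd.differentiableOn (by norm_num)
    have hddu : DifferentiableOn ℝ (derivWithin u (Ioc 0 T)) (Ioc 0 T) :=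
      (hcd.derivWithin (m := 1) hud (by norm_num)).differentiableOn (by norm_num)
    have hqs : derivWithin u (Ioc 0 T) s = q := hq.derivWithin (hud s hs')
    have hts : 0 < t - s := by linarith [hs.2]
    have hlip : ∀ r ∈ Icc s t, |derivWithin u (Ioc 0 T) r - q| ≤ |Mt| * (t - s) := by
      intro r hr
      have hr' : r ∈ Ioc 0 T := ⟨hs.1.trans_le hr.1, hr.2.trans htT⟩
      have h₁ := (convex_Ioc 0 T).norm_image_sub_le_of_norm_derivWithin_le (C := |Mt|) hddu
        (fun z hz => by
          have h₂ := hbd z hz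
          rw [iteratedDerivWithin_succ, iteratedDerivWithin_one] at h₂
          exact h₂.trans (le_abs_self _)) hs' hr'
      rw [hqs, Real.norm_eq_abs, Real.norm_eq_abs, abs_of_nonneg (sub_nonneg.2 hr.1)] at h₁
      refine h₁.trans (mul_le_mul_of_nonneg_left ?_ (abs_nonneg _))
      linarith [hr.2]
    have htime : |u t - u s - (t - s) * q| ≤ |Mt| * (t - s) ^ 2 := by
      have h₁ := (convex_Icc s t).norm_image_sub_le_of_norm_hasDerivWithin_le
        (f := fun r => u r - r * q) (f' := fun r => derivWithin u (Ioc 0 T) r - q)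
        (C := |Mt| * (t - s))
        (fun r hr => by
          have hr' : r ∈ Ioc 0 T := ⟨hs.1.trans_le hr.1, hr.2.trans htT⟩
          have h₂ := ((hdu r hr').hasDerivWithinAt.mono
            (fun z hz => (⟨hs.1.trans_le hz.1, hz.2.trans htT⟩ : z ∈ Ioc 0 T)) :
              HasDerivWithinAt u _ (Icc s t) r)
          have h₃ : HasDerivWithinAt (fun r => u r - r * q) _ (Icc s t) r :=
            h₂.sub ((hasDerivWithinAt_id r (Icc s t)).mul_const q)
          simpa using h₃)
        hlip (left_mem_Icc.2 hs.2.le) (right_mem_Icc.2 hs.2.le)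
      rw [Real.norm_eq_abs, Real.norm_eq_abs, abs_of_pos hts] at h₁
      calc |u t - u s - (t - s) * q| = |u t - t * q - (u s - s * q)| := by ring_nf
        _ ≤ |Mt| * (t - s) * (t - s) := h₁
        _ = |Mt| * (t - s) ^ 2 := by ring
    have hhσ : 0 < h ^ σ := Real.rpow_pos_of_pos hh σ
    -- The leading term `(q / ν_σ) h^σ` of the spatial increment contributes exactly `(t - s) q`, so
    -- a time remainder and a space remainder are left.
    have hsplit : u t - u s - nu σ * ((t - s) / h ^ σ) * (w x h s - w x 0 s) =
        (u t - u s - (t - s) * q) -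
          nu σ * ((t - s) / h ^ σ) * (w x h s - w x 0 s - q / nu σ * h ^ σ) := by
      field_simp
      ring
    have h2 : h ^ 2 = h ^ (2 - σ) * h ^ σ := by
      rw [← Real.rpow_add hh]
      norm_num
    have hfac : 0 ≤ nu σ * ((t - s) / h ^ σ) := by positivity
    have hsp : |nu σ * ((t - s) / h ^ σ) * (w x h s - w x 0 s - q / nu σ * h ^ σ)| ≤
        nu σ * |c| * ((t - s) * h ^ (2 - σ)) := by
      rw [abs_mul, abs_of_nonneg hfac]
      calc nu σ * ((t - s) / h ^ σ) * |w x h s - w x 0 s - q / nu σ * h ^ σ|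
          ≤ nu σ * ((t - s) / h ^ σ) * (|c| * h ^ 2) := by
            refine mul_le_mul_of_nonneg_left (hspace.trans ?_) hfac
            exact mul_le_mul_of_nonneg_right (le_abs_self c) (sq_nonneg h)
        _ = nu σ * |c| * ((t - s) * h ^ (2 - σ)) := by
            rw [h2]
            field_simp
    have hgoal : |u t - u s - nu σ * ((t - s) / h ^ σ) * (w x h s - w x 0 s)| ≤
        (|Mt| + nu σ * |c|) * ((t - s) ^ 2 + (t - s) * h ^ (2 - σ)) := by
      rw [hsplit]
      refine (abs_sub _ _).trans ((add_le_add htime hsp).trans ?_)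
      have e₁ : 0 ≤ |Mt| * ((t - s) * h ^ (2 - σ)) := by positivity
      have e₂ : 0 ≤ nu σ * |c| * (t - s) ^ 2 := by positivity
      linarith
    exact hgoal
  · rw [hclos]
    exact ((continuousOn_const.sub hcu).sub (ContinuousOn.mul (by fun_prop)
      ((hcw h ⟨hh.le, hhY⟩).sub (hcw 0 h0Y)))).abs
  · fun_prop


/-! ### Convexity of powers and the propagation of errors over one step -/

/-- Bernoulli's inequality at `a / b`. The Lipschitz constant `m N^(m-1)` is the one in the step
restriction. -/
theorem rpow_sub_rpow_le {m a b N : ℝ} (hm : 1 ≤ m) (ha : 0 ≤ a) (hab : a ≤ b) (hbN : b ≤ N) :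
    b ^ m - a ^ m ≤ m * N ^ (m - 1) * (b - a) := by
  have hm0 : 0 < m := by linarith
  rcases (ha.trans hab).eq_or_lt with rfl | hb
  · have : a = 0 := le_antisymm hab ha
    simp [this]
  have hbern : 1 + m * (a / b - 1) ≤ (a / b) ^ m := by
    have := one_add_mul_self_le_rpow_one_add (s := a / b - 1)
      (by have := div_nonneg ha hb.le; linarith) hm
    simpa using this
  rw [Real.div_rpow ha hb.le, le_div_iff₀ (Real.rpow_pos_of_pos hb m)] at hbern
  have hsplit : b ^ m = b ^ (m - 1) * b := by
    rw [← Real.rpow_add_one hb.ne', sub_add_cancel]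
  have h₁ : (1 + m * (a / b - 1)) * b ^ m = b ^ m + m * b ^ (m - 1) * (a - b) := by
    rw [hsplit]
    field_simp
  have h₂ : m * b ^ (m - 1) * (b - a) ≤ m * N ^ (m - 1) * (b - a) := by
    have := Real.rpow_le_rpow hb.le hbN (by linarith : 0 ≤ m - 1)
    have h3 : 0 ≤ b - a := by linarith
    gcongr
  linarith

/-- Increments of a convex power are nondecreasing. -/
theorem rpow_increment_mono {m a c r : ℝ} (hm : 1 ≤ m) (ha : 0 ≤ a) (hac : a ≤ c) (hr : 0 ≤ r) :
    (a + r) ^ m - a ^ m ≤ (c + r) ^ m - c ^ m := by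
  rcases (by linarith : 0 ≤ c + r - a).eq_or_lt with h0 | hL
  · have h₁ : r = 0 := by linarith
    simp [h₁]
  have hconv := convexOn_rpow hm
  have hl0 : 0 ≤ r / (c + r - a) := div_nonneg hr hL.le
  have hl1 : 0 ≤ (c - a) / (c + r - a) := div_nonneg (by linarith) hL.le
  have hsum : (c - a) / (c + r - a) + r / (c + r - a) = 1 := by
    rw [← add_div, div_eq_one_iff_eq hL.ne']
    ring
  have hcr : 0 ≤ c + r := by linarith
  -- `a + r` and `c` are convex combinations of `a` and `c + r` with interchanged weights; the claim
  -- is the sum of the two convexity inequalities.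
  have h₁ := hconv.2 (mem_Ici.2 ha) (mem_Ici.2 hcr) hl1 hl0 hsum
  have h₂ := hconv.2 (mem_Ici.2 ha) (mem_Ici.2 hcr) hl0 hl1 (by linarith)
  simp only [smul_eq_mul] at h₁ h₂
  have e₁ : (c - a) / (c + r - a) * a + r / (c + r - a) * (c + r) = a + r := by
    field_simp
    ring
  have e₂ : r / (c + r - a) * a + (c - a) / (c + r - a) * (c + r) = c := by
    field_simp
    ring
  rw [e₁] at h₁
  rw [e₂] at h₂
  have e₃ : (c - a) / (c + r - a) * a ^ m + r / (c + r - a) * a ^ m = a ^ m := by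
    rw [← add_mul, hsum, one_mul]
  have e₄ : (c - a) / (c + r - a) * (c + r) ^ m + r / (c + r - a) * (c + r) ^ m =
      (c + r) ^ m := by
    rw [← add_mul, hsum, one_mul]
  linarith

/-- By convexity the increment at `u'` is at most the one at `θ u`; then `θ u + r ≤ θ (u + r)` and
homogeneity extract `θ^m`. For `m = 1` increments do not depend on the base point. -/
theorem rpow_increment_scale_up {m θ u u' r : ℝ} (hm : 1 ≤ m) (hθ : 1 ≤ θ) (hu : 0 ≤ u)
    (hu' : 0 ≤ u') (hr : 0 ≤ r) (hgr : m = 1 ∨ u' ≤ θ * u) :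
    (u' + r) ^ m - u' ^ m ≤ θ ^ m * ((u + r) ^ m - u ^ m) := by
  have hθ0 : 0 ≤ θ := by linarith
  rcases hgr with rfl | hgr
  · simp only [Real.rpow_one]
    nlinarith
  have h₁ := rpow_increment_mono hm hu' hgr hr
  have h₂ : (θ * u + r) ^ m ≤ (θ * (u + r)) ^ m :=
    Real.rpow_le_rpow (by positivity) (by nlinarith) (by linarith)
  rw [Real.mul_rpow hθ0 (by linarith)] at h₂
  rw [Real.mul_rpow hθ0 hu] at h₁
  linarith

/-- The counterpart for errors from below; the truncation at `0` is needed because `r` may exceed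
`u'`. -/
theorem rpow_increment_scale_down {m θ u u' r : ℝ} (hm : 1 ≤ m) (hθ : 1 ≤ θ)
    (hu' : 0 ≤ u') (hr : 0 ≤ r) (hru : r ≤ u) (hgr : m = 1 ∨ u' ≤ θ * u) :
    u' ^ m - max (u' - r) 0 ^ m ≤ θ ^ m * (u ^ m - (u - r) ^ m) := by
  have hθ0 : 0 ≤ θ := by linarith
  have hm0 : m ≠ 0 := by linarith
  have hu : 0 ≤ u := hr.trans hru
  rcases hgr with rfl | hgr
  · simp only [Real.rpow_one]
    have := le_max_left (u' - r) 0
    nlinarith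
  have hθu : r ≤ θ * u := by nlinarith
  have h₁ : u' ^ m - max (u' - r) 0 ^ m ≤ (θ * u) ^ m - (θ * u - r) ^ m := by
    rcases le_total r u' with h | h
    · have := rpow_increment_mono hm (sub_nonneg.2 h) (sub_le_sub_right hgr r) hr
      rw [max_eq_left (sub_nonneg.2 h)]
      simpa using this
    · have h₂ := rpow_increment_mono hm le_rfl (sub_nonneg.2 hθu) hr
      have h₃ := Real.rpow_le_rpow hu' h (by linarith : 0 ≤ m)
      rw [max_eq_right (sub_nonpos.2 h)]
      simp only [zero_add, sub_add_cancel, Real.zero_rpow hm0] at h₂ ⊢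
      linarith
  have h₂ : (θ * (u - r)) ^ m ≤ (θ * u - r) ^ m :=
    Real.rpow_le_rpow (mul_nonneg hθ0 (by linarith)) (by nlinarith) (by linarith)
  rw [Real.mul_rpow hθ0 (by linarith)] at h₂
  rw [Real.mul_rpow hθ0 hu] at h₁
  linarith

/-- One step of the scheme on the base preserves an upper bound for the error. -/
theorem step_error_upper {m N l θ u u' v U U' V P ε τ : ℝ} (hm : 1 ≤ m) (hl : 0 ≤ l)
    (hcfl : l * (m * N ^ (m - 1)) ≤ 1) (hθ : 1 ≤ θ) (hP : 0 ≤ P) (hε : 0 ≤ ε) (hτ : 0 ≤ τ)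
    (hu : u ∈ Icc 0 N) (hu' : u' ∈ Icc 0 N) (hU : U ∈ Icc 0 N) (hU' : U' ∈ Icc 0 N)
    (hstep : U' = U - l * U ^ m + l * V) (hcons : |u' - (u + l * (v - u ^ m))| ≤ τ)
    (hgr : m = 1 ∨ u' ≤ θ * u) (hV : V ≤ v + P + ε) (hbase : U ^ m ≤ u ^ m + P) :
    U' ^ m ≤ u' ^ m + θ ^ m * P + m * N ^ (m - 1) * (τ + l * ε) := by
  set Φ := m * N ^ (m - 1) with hΦ
  have hN : 0 ≤ N := hu.1.trans hu.2
  have hΦ0 : 0 ≤ Φ := mul_nonneg (by linarith) (Real.rpow_nonneg hN _)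
  -- By monotonicity of the scheme `U` may be replaced by `s ≥ u`, so the error in `u` becomes the
  -- nonnegative shift `s - u`.
  set s := max U u with hs
  have hsN : s ≤ N := max_le hU.2 hu.2
  have hUs : U ≤ s := le_max_left _ _
  have hus : u ≤ s := le_max_right _ _
  have heP : s ^ m - u ^ m ≤ P := by
    rcases max_choice U u with h | h <;> rw [hs, h] <;> linarith
  have hmon : U - l * U ^ m ≤ s - l * s ^ m := by
    have h₁ := mul_le_mul_of_nonneg_left (rpow_sub_rpow_le hm hU.1 hUs hsN) hl
    have h₂ := mul_le_mul_of_nonneg_right hcfl (sub_nonneg.2 hUs)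
    nlinarith
  have hc := neg_le_of_abs_le hcons
  have hc' := le_of_abs_le hcons
  have hlV := mul_le_mul_of_nonneg_left hV hl
  -- The part of the bound `P` not used up by `s^m - u^m`, entering through the neighbour `V`,
  -- together with the truncation errors.
  set κ := l * (P - (s ^ m - u ^ m)) + τ + l * ε with hκ
  have hκ0 : 0 ≤ κ := by
    have := mul_nonneg hl (sub_nonneg.2 heP)
    have := mul_nonneg hl hε
    linarith
  have hbound : U' ≤ u' + (s - u) + κ := by
    rw [hstep, hκ]
    linarith
  have hr : 0 ≤ s - u := sub_nonneg.2 hus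
  have hfirst : U' ^ m ≤ (u' + (s - u)) ^ m + Φ * κ := by
    rcases le_total U' (u' + (s - u)) with h | h
    · have := Real.rpow_le_rpow hU'.1 h (by linarith : 0 ≤ m)
      have := mul_nonneg hΦ0 hκ0
      linarith
    · have h₁ := rpow_sub_rpow_le hm (add_nonneg hu'.1 hr) h hU'.2
      have h₂ : Φ * (U' - (u' + (s - u))) ≤ Φ * κ :=
        mul_le_mul_of_nonneg_left (by linarith) hΦ0
      linarith
  have hsecond := rpow_increment_scale_up hm hθ hu.1 hu'.1 hr hgr
  rw [add_sub_cancel] at hsecond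
  have hθm : 1 ≤ θ ^ m := Real.one_le_rpow hθ (by linarith)
  -- Here `l Φ ≤ 1` is decisive: the unused part of `P` comes back with factor at most one, and adds
  -- up with `θ^m (s^m - u^m)` to at most `θ^m P`.
  have h₃ : Φ * κ ≤ (P - (s ^ m - u ^ m)) + Φ * (τ + l * ε) := by
    have := mul_le_mul_of_nonneg_right hcfl (sub_nonneg.2 heP)
    rw [hκ]
    linarith
  have h₄ := mul_le_mul_of_nonneg_right hθm (sub_nonneg.2 heP)
  linarith

/-- One step of the scheme on the base preserves a lower bound for the error. -/
theorem step_error_lower {m N l θ u u' v U U' V P ε τ : ℝ} (hm : 1 ≤ m) (hl : 0 ≤ l)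
    (hcfl : l * (m * N ^ (m - 1)) ≤ 1) (hθ : 1 ≤ θ) (hP : 0 ≤ P) (hε : 0 ≤ ε) (hτ : 0 ≤ τ)
    (hu : u ∈ Icc 0 N) (hu' : u' ∈ Icc 0 N) (hU : U ∈ Icc 0 N) (hU' : U' ∈ Icc 0 N)
    (hstep : U' = U - l * U ^ m + l * V) (hcons : |u' - (u + l * (v - u ^ m))| ≤ τ)
    (hgr : m = 1 ∨ u' ≤ θ * u) (hV : v ≤ V + P + ε) (hbase : u ^ m ≤ U ^ m + P) :
    u' ^ m ≤ U' ^ m + θ ^ m * P + m * N ^ (m - 1) * (τ + l * ε) := by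
  set Φ := m * N ^ (m - 1) with hΦ
  have hN : 0 ≤ N := hu.1.trans hu.2
  have hΦ0 : 0 ≤ Φ := mul_nonneg (by linarith) (Real.rpow_nonneg hN _)
  set s := min U u with hs
  have hs0 : 0 ≤ s := le_min hU.1 hu.1
  have hUs : s ≤ U := min_le_left _ _
  have hus : s ≤ u := min_le_right _ _
  have heP : u ^ m - s ^ m ≤ P := by
    rcases min_choice U u with h | h <;> rw [hs, h] <;> linarith
  have hmon : s - l * s ^ m ≤ U - l * U ^ m := by
    have h₁ := mul_le_mul_of_nonneg_left (rpow_sub_rpow_le hm hs0 hUs hU.2) hl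
    have h₂ := mul_le_mul_of_nonneg_right hcfl (sub_nonneg.2 hUs)
    nlinarith
  have hc' := le_of_abs_le hcons
  have hlV := mul_le_mul_of_nonneg_left hV hl
  set κ := l * (P - (u ^ m - s ^ m)) + τ + l * ε with hκ
  have hκ0 : 0 ≤ κ := by
    have := mul_nonneg hl (sub_nonneg.2 heP)
    have := mul_nonneg hl hε
    linarith
  have hbound : u' - (u - s) ≤ U' + κ := by
    rw [hstep, hκ]
    linarith
  have hr : 0 ≤ u - s := sub_nonneg.2 hus
  -- The shifted value `u' - (u - s)` may be negative; truncating keeps the bound because `U' + κ ≥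
  -- 0`.
  have hmx : max (u' - (u - s)) 0 ≤ U' + κ := max_le hbound (add_nonneg hU'.1 hκ0)
  have hmx0 : 0 ≤ max (u' - (u - s)) 0 := le_max_right _ _
  have hmxN : max (u' - (u - s)) 0 ≤ N := max_le (by linarith [hu'.2]) hN
  have hfirst : max (u' - (u - s)) 0 ^ m ≤ U' ^ m + Φ * κ := by
    rcases le_total (max (u' - (u - s)) 0) U' with h | h
    · have := Real.rpow_le_rpow hmx0 h (by linarith : 0 ≤ m)
      have := mul_nonneg hΦ0 hκ0
      linarith
    · have h₁ := rpow_sub_rpow_le hm hU'.1 h hmxN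
      have h₂ : Φ * (max (u' - (u - s)) 0 - U') ≤ Φ * κ :=
        mul_le_mul_of_nonneg_left (by linarith) hΦ0
      linarith
  have hsecond := rpow_increment_scale_down hm hθ hu'.1 hr (by linarith) hgr
  rw [sub_sub_cancel] at hsecond
  have hθm : 1 ≤ θ ^ m := Real.one_le_rpow hθ (by linarith)
  have h₃ : Φ * κ ≤ (P - (u ^ m - s ^ m)) + Φ * (τ + l * ε) := by
    have := mul_le_mul_of_nonneg_right hcfl (sub_nonneg.2 heP)
    rw [hκ]
    linarith
  have h₄ := mul_le_mul_of_nonneg_right hθm (sub_nonneg.2 heP)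
  linarith

/-! ### Geometry of the mesh -/

namespace Mesh

variable {X Y : ℝ} (M : Mesh X Y)

theorem dx_pos (hX : 0 < X) : 0 < M.dx := by
  have : (0 : ℝ) < M.I := by exact_mod_cast M.I_pos
  unfold dx
  positivity

theorem I_mul_dx : (M.I : ℝ) * M.dx = 2 * X := by
  have : (M.I : ℝ) ≠ 0 := by exact_mod_cast M.I_pos.ne'
  unfold dx
  field_simp

theorem K_mul_dx : (M.K : ℝ) * M.dx = Y := by
  have : (M.K : ℝ) ≠ 0 := by exact_mod_cast M.K_pos.ne'
  unfold dx
  rw [M.square]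
  field_simp

theorem dx_le_two_mul (hX : 0 < X) : M.dx ≤ 2 * X := by
  rw [← M.I_mul_dx]
  exact le_mul_of_one_le_left (M.dx_pos hX).le (by exact_mod_cast M.I_pos)

theorem dx_le_height (hX : 0 < X) : M.dx ≤ Y := by
  have h : M.dx ≤ M.K * M.dx :=
    le_mul_of_one_le_left (M.dx_pos hX).le (by exact_mod_cast M.K_pos)
  rwa [M.K_mul_dx] at h

theorem x_mem_Icc (hX : 0 < X) (i : Fin (M.I + 1)) : M.x i ∈ Icc (-X) X := by
  have hd := M.dx_pos hX
  have h₁ : ((i : ℕ) : ℝ) * M.dx ≤ M.I * M.dx :=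
    mul_le_mul_of_nonneg_right (by exact_mod_cast Nat.lt_succ_iff.1 i.2) hd.le
  have h₂ : 0 ≤ ((i : ℕ) : ℝ) * M.dx := by positivity
  rw [M.I_mul_dx] at h₁
  constructor <;> unfold x <;> linarith

theorem x_mem_Ioo (hX : 0 < X) {i : Fin (M.I + 1)} (hi : M.InnerCol i) :
    M.x i ∈ Ioo (-X) X := by
  have hd := M.dx_pos hX
  have h₁ : ((i : ℕ) : ℝ) * M.dx < M.I * M.dx :=
    mul_lt_mul_of_pos_right (by exact_mod_cast hi.2) hd
  have h₂ : 0 < ((i : ℕ) : ℝ) * M.dx := mul_pos (by exact_mod_cast hi.1) hd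
  rw [M.I_mul_dx] at h₁
  constructor <;> unfold x <;> linarith

theorem y_mem_Icc (hX : 0 < X) (k : Fin (M.K + 1)) : M.y k ∈ Icc 0 Y := by
  have hd := M.dx_pos hX
  have h₁ : ((k : ℕ) : ℝ) * M.dx ≤ M.K * M.dx :=
    mul_le_mul_of_nonneg_right (by exact_mod_cast Nat.lt_succ_iff.1 k.2) hd.le
  rw [M.K_mul_dx] at h₁
  exact ⟨by unfold y; positivity, h₁⟩

theorem y_mem_Ioo (hX : 0 < X) {k : Fin (M.K + 1)} (hk : M.InnerRow k) : M.y k ∈ Ioo 0 Y := by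
  have hd := M.dx_pos hX
  have h₁ : ((k : ℕ) : ℝ) * M.dx < M.K * M.dx :=
    mul_lt_mul_of_pos_right (by exact_mod_cast hk.2) hd
  rw [M.K_mul_dx] at h₁
  exact ⟨mul_pos (by exact_mod_cast hk.1) hd, h₁⟩

theorem y_zero : M.y 0 = 0 := by simp [y]

theorem innerCol_of_not_lateral {i : Fin (M.I + 1)} {k : Fin (M.K + 1)} (h : ¬ M.Lateral i k) :
    M.InnerCol i := by
  unfold Lateral at h
  unfold InnerCol
  have := i.2
  omega

theorem eq_of_lateral {i : Fin (M.I + 1)} {k : Fin (M.K + 1)} (h : M.Lateral i k) :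
    M.x i = -X ∨ M.x i = X ∨ M.y k = Y := by
  unfold x y
  rcases h with h | h | h
  · left
    simp [h]
  · right; left
    rw [h, M.I_mul_dx]
    ring
  · right; right
    rw [h, M.K_mul_dx]

end Mesh

/-! ### Barriers, discrete stability and interior truncation -/

/-- A quadratic polynomial that is a strict subsolution, bounded on the rectangle. -/
theorem exists_barrier {σ X Y : ℝ} (hσ0 : 0 < σ) (hX : 0 < X) (hY : 0 < Y)
    {R : Set (ℝ → ℝ → ℝ → ℝ)}
    (hpoly : ∀ c₀ c₁ c₂ c₃ c₄ c₅ : ℝ,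
      (fun x y _ => c₀ + c₁ * x + c₂ * y + c₃ * x ^ 2 + c₄ * x * y + c₅ * y ^ 2) ∈ R) :
    ∃ v : ℝ → ℝ → ℝ, (fun x y _ => v x y) ∈ R ∧ ∃ c > 0, ∃ B ≥ 0,
      (∀ x ∈ Ioo (-X) X, ∀ y ∈ Ioo 0 Y, c ≤ extOp σ v x y) ∧
      ∀ x ∈ Icc (-X) X, ∀ y ∈ Icc 0 Y, v x y ∈ Icc 0 B := by
  -- `L_σ y = (1-σ) y^(-σ)` is positive only for `σ < 1`, and `L_σ x² = 2 y^(1-σ)` stays away from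
  -- `0` only for `σ ≥ 1`. In each case the chosen power of `y` is nonincreasing, so its value at
  -- `Y` is a lower bound.
  rcases lt_or_ge σ 1 with hσ | hσ
  · refine ⟨fun x y => y, by simpa using hpoly 0 0 1 0 0 0, (1 - σ) * Y ^ (1 - σ - 1), ?_,
      Y, hY.le, ?_, fun x _ y hy => hy⟩
    · exact mul_pos (by linarith) (Real.rpow_pos_of_pos hY _)
    · intro x _ y hy
      have : extOp σ (fun _ y => y) x y = (1 - σ) * y ^ (1 - σ - 1) := by
        simp [extOp, Real.deriv_rpow_const]
      rw [this]
      exact mul_le_mul_of_nonneg_left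
        (Real.rpow_le_rpow_of_nonpos hy.1 hy.2.le (by linarith)) (by linarith)
  · refine ⟨fun x y => x ^ 2, by simpa using hpoly 0 0 0 1 0 0, Y ^ (1 - σ) * 2, ?_,
      X ^ 2, by positivity, ?_, fun x hx y _ => ⟨sq_nonneg x, sq_le_sq' hx.1 hx.2⟩⟩
    · have := Real.rpow_pos_of_pos hY (1 - σ)
      positivity
    · intro x _ y hy
      have : extOp σ (fun x _ => x ^ 2) x y = y ^ (1 - σ) * 2 := by
        simp [extOp]
      rw [this]
      exact mul_le_mul_of_nonneg_right
          (Real.rpow_le_rpow_of_nonpos hy.1 hy.2.le (by linarith)) (by norm_num)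


/-- The discrete maximum principle with a right-hand side. -/
theorem HasOrder.exists_stability {σ X Y T a : ℝ} {LD : Discretization X Y}
    {R : Set (ℝ → ℝ → ℝ → ℝ)} (hord : HasOrder σ X Y T a LD R) (hmax : MaxPrinciple LD)
    (hσ0 : 0 < σ) (hX : 0 < X) (hY : 0 < Y) (hT : 0 < T) (ha : 0 < a)
    (hpoly : ∀ c₀ c₁ c₂ c₃ c₄ c₅ : ℝ,
      (fun x y _ => c₀ + c₁ * x + c₂ * y + c₃ * x ^ 2 + c₄ * x * y + c₅ * y ^ 2) ∈ R) :
    ∃ δ > 0, ∃ S ≥ 0, ∀ M : Mesh X Y, M.dx ≤ δ → ∀ (V : M.Grid) (b c : ℝ), 0 ≤ b → 0 ≤ c →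
      (∀ i k, M.InnerCol i → M.InnerRow k → -c ≤ LD M V i k) →
      (∀ i k, (M.Lateral i k ∨ (k : ℕ) = 0) → V i k ≤ b) → ∀ i k, V i k ≤ b + S * c := by
  obtain ⟨v, hvR, c₀, hc₀, B, hB, hsub, hv⟩ := exists_barrier (σ := σ) hσ0 hX hY hpoly
  obtain ⟨C, hC⟩ := hord _ hvR
  have hlim : Tendsto (fun δ : ℝ => |C| * δ ^ a) (𝓝[>] 0) (𝓝 0) := by
    have h₁ : Tendsto (fun δ : ℝ => |C| * δ ^ a) (𝓝 0) (𝓝 (|C| * (0 : ℝ) ^ a)) :=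
      ((Real.continuous_rpow_const ha.le).const_mul _).tendsto 0
    rw [Real.zero_rpow ha.ne', mul_zero] at h₁
    exact h₁.mono_left nhdsWithin_le_nhds
  -- For `Δx ≤ δ` the truncation error of the barrier is below `c₀ / 2`, so the sampled barrier
  -- remains a strict discrete subsolution.
  obtain ⟨δ, hδ, hδ0⟩ := ((hlim.eventually (gt_mem_nhds (half_pos hc₀))).and
    self_mem_nhdsWithin).exists
  refine ⟨δ, hδ0, 2 * B / c₀, by positivity, ?_⟩
  intro M hM V b c hb hc hint hbd i k
  have hG : ∀ i k, M.InnerCol i → M.InnerRow k → c₀ / 2 ≤ LD M (M.sample v) i k := by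
    intro i k hi hk
    have h₁ := neg_le_of_abs_le (hC M T ⟨hT, le_rfl⟩ i k hi hk)
    have h₂ := hsub _ (M.x_mem_Ioo hX hi) _ (M.y_mem_Ioo hX hk)
    have h₃ : C * M.dx ^ a ≤ |C| * δ ^ a :=
      (mul_le_mul_of_nonneg_right (le_abs_self C)
        (Real.rpow_nonneg (M.dx_pos hX).le a)).trans (mul_le_mul_of_nonneg_left
          (Real.rpow_le_rpow (M.dx_pos hX).le hM ha.le) (abs_nonneg C))
    linarith
  have hvG : ∀ i k, M.sample v i k ∈ Icc 0 B := fun i k =>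
    hv _ (M.x_mem_Icc hX i) _ (M.y_mem_Icc hX k)
  have hr : 0 ≤ 2 * c / c₀ := by positivity
  -- Adding the multiple `2c / c₀` of the barrier compensates the right-hand side `-c`.
  have key := hmax M (V + (2 * c / c₀) • M.sample v) (b + 2 * c / c₀ * B)
    (add_nonneg hb (mul_nonneg hr hB))
    (fun i k hi hk => by
      rw [map_add, map_smul]
      have h₁ := mul_le_mul_of_nonneg_left (hG i k hi hk) hr
      have h₂ : 2 * c / c₀ * (c₀ / 2) = c := by field_simp
      have h₃ := hint i k hi hk
      simp only [Pi.add_apply, Pi.smul_apply, smul_eq_mul]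
      linarith)
    (fun i k h => by
      simp only [Pi.add_apply, Pi.smul_apply, smul_eq_mul]
      exact add_le_add (hbd i k h) (mul_le_mul_of_nonneg_left (hvG i k).2 hr)) i k
  simp only [Pi.add_apply, Pi.smul_apply, smul_eq_mul] at key
  have h₁ := mul_nonneg hr (hvG i k).1
  have h₂ : 2 * B / c₀ * c = 2 * c / c₀ * B := by ring
  linarith

/-- The exact solution satisfies the discrete equation up to `O(Δx^a)`, also at `t = 0`. -/
theorem IsClassicalSolution.exists_truncation {σ m X Y T a : ℝ} {f : ℝ → ℝ}
    {w : ℝ → ℝ → ℝ → ℝ} (hw : IsClassicalSolution σ m X Y T f w) (hX : 0 < X) (hT : 0 < T)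
    {LD : Discretization X Y} {R : Set (ℝ → ℝ → ℝ → ℝ)} (hord : HasOrder σ X Y T a LD R)
    (hwR : w ∈ R) : ∃ C ≥ 0, ∀ M : Mesh X Y, ∀ t ∈ Icc 0 T, ∀ i k, M.InnerCol i →
      M.InnerRow k → |LD M (M.sample fun x y => w x y t) i k| ≤ C * M.dx ^ a := by
  obtain ⟨C, hC⟩ := hord w hwR
  refine ⟨|C|, abs_nonneg C, fun M t ht i k hi hk => ?_⟩
  have hclos : closure (Ioc 0 T) = Icc 0 T := closure_Ioc hT.ne
  -- On a fixed mesh the discrete operator is linear on a finite-dimensional space, hence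
  -- continuous, so the bound passes to `t = 0`.
  refine le_on_closure (s := Ioc 0 T)
    (f := fun t => |LD M (M.sample fun x y => w x y t) i k|) (g := fun _ => |C| * M.dx ^ a)
    ?_ ?_ continuousOn_const (hclos ▸ ht)
  · intro s hs
    have h := hC M s hs i k hi hk
    rw [hw.interior_eq s hs _ (M.x_mem_Ioo hX hi) _ (M.y_mem_Ioo hX hk), sub_zero] at h
    exact h.trans (mul_le_mul_of_nonneg_right (le_abs_self C)
      (Real.rpow_nonneg (M.dx_pos hX).le a))
  · rw [hclos]
    have h₁ : ContinuousOn (fun t => M.sample fun x y => w x y t) (Icc 0 T) :=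
      continuousOn_pi.2 fun i => continuousOn_pi.2 fun k =>
        hw.continuousOn_t (M.x_mem_Icc hX i) (M.y_mem_Icc hX k)
    have h₂ : Continuous (LD M) := (LD M).continuous_of_finiteDimensional
    have h₃ := h₂.comp_continuousOn h₁
    exact (continuousOn_pi.1 (continuousOn_pi.1 h₃ i) k).abs

/-! ### A priori bounds for the numerical solution -/

theorem rpow_rpow_one_div {m z : ℝ} (hm : m ≠ 0) (hz : 0 ≤ z) : (z ^ m) ^ (1 / m) = z := by
  rw [← Real.rpow_mul hz, mul_one_div_cancel hm, Real.rpow_one]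

theorem rpow_one_div_rpow {m z : ℝ} (hm : m ≠ 0) (hz : 0 ≤ z) : (z ^ (1 / m)) ^ m = z := by
  rw [← Real.rpow_mul hz, one_div_mul_cancel hm, Real.rpow_one]

/-- Under the step restriction the explicit scheme keeps values in `[0, N]`. -/
theorem step_mem_Icc {m N l U V : ℝ} (hm : 1 ≤ m) (hl : 0 ≤ l)
    (hcfl : l * (m * N ^ (m - 1)) ≤ 1) (hU : U ∈ Icc 0 N) (hV : V ∈ Icc 0 (N ^ m)) :
    U - l * U ^ m + l * V ∈ Icc 0 N := by
  have hm0 : m ≠ 0 := by linarith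
  have h₁ := mul_le_mul_of_nonneg_left (rpow_sub_rpow_le hm le_rfl hU.1 hU.2) hl
  have h₂ := mul_le_mul_of_nonneg_right hcfl hU.1
  have h₃ := mul_le_mul_of_nonneg_left (rpow_sub_rpow_le hm hU.1 hU.2 le_rfl) hl
  have h₄ := mul_le_mul_of_nonneg_right hcfl (sub_nonneg.2 hU.2)
  have h₅ := mul_le_mul_of_nonneg_left hV.1 hl
  have h₆ := mul_le_mul_of_nonneg_left hV.2 hl
  rw [Real.zero_rpow hm0] at h₁
  constructor <;> linarith

section Numerical

variable {σ m X Y : ℝ} {f : ℝ → ℝ} {LD : Discretization X Y} {M : Mesh X Y} {J : ℕ} {dt : ℝ}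
  {W : ℕ → M.Grid}

/-- The values of the numerical solution stay between `0` and `‖f‖^m`. -/
theorem IsNumericalSolution.mem_Icc (hW : IsNumericalSolution σ m f LD M J dt W)
    (hmax : MaxPrinciple LD) (hm : 1 ≤ m) (hX : 0 < X) (hf : ∀ x ∈ Icc (-X) X, 0 ≤ f x)
    {N : ℝ} (hN : ∀ x ∈ Icc (-X) X, f x ≤ N) (hl : 0 ≤ nu σ * (dt / M.dx ^ σ))
    (hcfl : nu σ * (dt / M.dx ^ σ) * (m * N ^ (m - 1)) ≤ 1) :
    ∀ j ≤ J, ∀ i k, W j i k ∈ Icc 0 (N ^ m) := by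
  have hm0 : m ≠ 0 := by linarith
  have hN0 : 0 ≤ N := (hf X ⟨by linarith, le_rfl⟩).trans (hN X ⟨by linarith, le_rfl⟩)
  have hNm : 0 ≤ N ^ m := Real.rpow_nonneg hN0 m
  have fill : ∀ j ≤ J, (∀ i, M.InnerCol i → W j i 0 ∈ Icc 0 (N ^ m)) →
      ∀ i k, W j i k ∈ Icc 0 (N ^ m) := by
    intro j hj hbase
    have hbd : ∀ i k, (M.Lateral i k ∨ (k : ℕ) = 0) → W j i k ∈ Icc 0 (N ^ m) := by
      intro i k h
      by_cases hlat : M.Lateral i k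
      · rw [hW.lateral j hj i k hlat]
        exact ⟨le_rfl, hNm⟩
      · have hk : k = 0 := Fin.ext (by simpa using h.resolve_left hlat)
        rw [hk]
        exact hbase i (M.innerCol_of_not_lateral hlat)
    intro i k
    constructor
    · have := hmax M (-W j) 0 le_rfl (fun i k hi hk => by
        rw [map_neg]
        simp [hW.interior j hj i k hi hk]) (fun i k h => by simpa using (hbd i k h).1) i k
      simpa using this
    · exact hmax M (W j) (N ^ m) hNm (fun i k hi hk => (hW.interior j hj i k hi hk).ge)
        (fun i k h => (hbd i k h).2) i k
  intro j
  induction j with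
  | zero =>
    refine fun hj => fill 0 hj fun i hi => ?_
    rw [hW.initial i hi]
    have h0 := hf _ (M.x_mem_Icc hX i)
    exact ⟨Real.rpow_nonneg h0 m,
      Real.rpow_le_rpow h0 (hN _ (M.x_mem_Icc hX i)) (by linarith)⟩
  | succ j ih =>
    intro hj
    refine fill _ hj fun i hi => ?_
    have hprev := ih (by omega)
    rw [hW.step j (by omega) i hi ⟨1, by have := M.K_pos; omega⟩ rfl]
    have hU : W j i 0 ^ (1 / m) ∈ Icc 0 N := by
      refine ⟨Real.rpow_nonneg (hprev i 0).1 _, ?_⟩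
      have := Real.rpow_le_rpow (hprev i 0).1 (hprev i 0).2 (by positivity : 0 ≤ 1 / m)
      rwa [rpow_rpow_one_div hm0 hN0] at this
    have hs := step_mem_Icc hm hl hcfl hU (hprev i ⟨1, by have := M.K_pos; omega⟩)
    rw [rpow_one_div_rpow hm0 (hprev i 0).1] at hs
    have hs' : nu σ * (dt / M.dx ^ σ) * (W j i ⟨1, by have := M.K_pos; omega⟩ - W j i 0) +
        W j i 0 ^ (1 / m) ∈ Icc 0 N := by
      convert hs using 1
      ring
    exact ⟨Real.rpow_nonneg hs'.1 m, Real.rpow_le_rpow hs'.1 hs'.2 (by linarith)⟩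

/-- The scheme written for `U = W^(1/m)` on the base. -/
theorem IsNumericalSolution.root_step (hW : IsNumericalSolution σ m f LD M J dt W)
    (hm : 1 ≤ m) {N : ℝ} (hN0 : 0 ≤ N) (hl : 0 ≤ nu σ * (dt / M.dx ^ σ))
    (hcfl : nu σ * (dt / M.dx ^ σ) * (m * N ^ (m - 1)) ≤ 1)
    (hWN : ∀ j ≤ J, ∀ i k, W j i k ∈ Icc 0 (N ^ m)) {j : ℕ} (hj : j < J) {i : Fin (M.I + 1)}
    (hi : M.InnerCol i) {k₁ : Fin (M.K + 1)} (hk₁ : (k₁ : ℕ) = 1) :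
    W (j + 1) i 0 ^ (1 / m) = W j i 0 ^ (1 / m) -
      nu σ * (dt / M.dx ^ σ) * (W j i 0 ^ (1 / m)) ^ m + nu σ * (dt / M.dx ^ σ) * W j i k₁ := by
  have hm0 : m ≠ 0 := by linarith
  have hprev := hWN j hj.le
  have hU : W j i 0 ^ (1 / m) ∈ Icc 0 N := by
    refine ⟨Real.rpow_nonneg (hprev i 0).1 _, ?_⟩
    have := Real.rpow_le_rpow (hprev i 0).1 (hprev i 0).2 (by positivity : 0 ≤ 1 / m)
    rwa [rpow_rpow_one_div hm0 hN0] at this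
  have hs := step_mem_Icc hm hl hcfl hU (hprev i k₁)
  rw [hW.step j hj i hi k₁ hk₁, rpow_one_div_rpow hm0 (hprev i 0).1]
  rw [rpow_one_div_rpow hm0 (hprev i 0).1] at hs
  have he : nu σ * (dt / M.dx ^ σ) * (W j i k₁ - W j i 0) + W j i 0 ^ (1 / m) =
      W j i 0 ^ (1 / m) - nu σ * (dt / M.dx ^ σ) * W j i 0 +
        nu σ * (dt / M.dx ^ σ) * W j i k₁ := by ring
  -- The bracket of the scheme is nonnegative by `hs`, so the root inverts the power.
  rw [he, rpow_rpow_one_div hm0 hs.1]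

end Numerical

/-! ### Accumulation of errors and the convergence rate -/

/-- The error on a sufficiently fine mesh, in terms of the truncation errors `τ` on the base and
`ε` in the interior. -/
theorem error_le_of_truncation {σ m X Y T : ℝ} {f : ℝ → ℝ} {w : ℝ → ℝ → ℝ → ℝ}
    (hw : IsClassicalSolution σ m X Y T f w) (hm : 1 ≤ m) (hX : 0 < X) (hY : 0 < Y)
    {LD : Discretization X Y} {M : Mesh X Y} {J : ℕ} {dt : ℝ} {W : ℕ → M.Grid}
    (hW : IsNumericalSolution σ m f LD M J dt W) (hdt : 0 < dt) (hJT : J * dt = T)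
    {N A τ ε c S : ℝ} (hN0 : 0 ≤ N) (hA : 0 ≤ A) (hτ : 0 ≤ τ) (hc : 0 ≤ c) (hS : 0 ≤ S)
    (hε : ε = S * c)
    (hl : 0 ≤ nu σ * (dt / M.dx ^ σ))
    (hcfl : nu σ * (dt / M.dx ^ σ) * (m * N ^ (m - 1)) ≤ 1)
    (hWN : ∀ j ≤ J, ∀ i k, W j i k ∈ Icc 0 (N ^ m))
    (hwN : ∀ x ∈ Icc (-X) X, ∀ t ∈ Icc 0 T, w x 0 t ^ (1 / m) ≤ N)
    (hgr : ∀ x ∈ Ioo (-X) X, ∀ s t : ℝ, 0 ≤ s → s < t → t ≤ T →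
      (m = 1 ∨ w x 0 t ^ (1 / m) ≤ Real.exp (A * (t - s)) * w x 0 s ^ (1 / m)))
    (hcons : ∀ x ∈ Ioo (-X) X, ∀ s t : ℝ, 0 ≤ s → s < t → t ≤ T → t - s = dt →
      |w x 0 t ^ (1 / m) - w x 0 s ^ (1 / m) -
        nu σ * ((t - s) / M.dx ^ σ) * (w x M.dx s - w x 0 s)| ≤ τ)
    (htr : ∀ t ∈ Icc 0 T, ∀ i k, M.InnerCol i → M.InnerRow k →
      |LD M (M.sample fun x y => w x y t) i k| ≤ c)
    (hstab : ∀ (V : M.Grid) (b : ℝ), 0 ≤ b →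
      (∀ i k, M.InnerCol i → M.InnerRow k → -c ≤ LD M V i k) →
      (∀ i k, (M.Lateral i k ∨ (k : ℕ) = 0) → V i k ≤ b) → ∀ i k, V i k ≤ b + S * c) :
    ∀ i k, |w (M.x i) (M.y k) T - W J i k| ≤
      J * Real.exp (A * T * m) *
        (m * N ^ (m - 1) * (τ + nu σ * (dt / M.dx ^ σ) * ε)) + ε := by
  have hm0 : m ≠ 0 := by linarith
  set l := nu σ * (dt / M.dx ^ σ) with hl_def
  set η := m * N ^ (m - 1) * (τ + l * ε) with hη_def
  have hε0 : 0 ≤ ε := hε ▸ mul_nonneg hS hc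
  have hη : 0 ≤ η := mul_nonneg (mul_nonneg (by linarith) (Real.rpow_nonneg hN0 _))
    (add_nonneg hτ (mul_nonneg hl hε0))
  have htime : ∀ j ≤ J, (j : ℝ) * dt ∈ Icc 0 T := fun j hj =>
    ⟨by positivity, hJT ▸ mul_le_mul_of_nonneg_right (by exact_mod_cast hj) hdt.le⟩
  -- A supersolution of the recursion `P (j + 1) = e^(A Δt m) P j + η` with `P 0 = 0`.
  set P : ℕ → ℝ := fun j => j * Real.exp (A * dt * m * j) * η with hP
  have hP0 : ∀ j, 0 ≤ P j := fun j => by simp only [hP]; positivity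
  -- a bound on the base propagates to all nodes
  have fill : ∀ j ≤ J, (∀ i, M.InnerCol i →
      |w (M.x i) 0 (j * dt) - W j i 0| ≤ P j) →
      ∀ i k, |w (M.x i) (M.y k) (j * dt) - W j i k| ≤ P j + ε := by
    intro j hj hbase
    have hbd : ∀ i k, (M.Lateral i k ∨ (k : ℕ) = 0) →
        |w (M.x i) (M.y k) (j * dt) - W j i k| ≤ P j := by
      intro i k h
      by_cases hlat : M.Lateral i k
      · rw [hW.lateral j hj i k hlat, hw.lateral_eq_zero hY (htime j hj) (M.x_mem_Icc hX i)
          (M.y_mem_Icc hX k) (M.eq_of_lateral hlat)]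
        simpa using hP0 j
      · have hk : k = 0 := Fin.ext (by simpa using h.resolve_left hlat)
        rw [hk, M.y_zero]
        exact hbase i (M.innerCol_of_not_lateral hlat)
    intro i k
    have hup := hstab ((M.sample fun x y => w x y (j * dt)) - W j) (P j) (hP0 j)
      (fun i k hi hk => by
        rw [map_sub, Pi.sub_apply, Pi.sub_apply, hW.interior j hj i k hi hk, sub_zero]
        exact neg_le_of_abs_le (htr _ (htime j hj) i k hi hk))
      (fun i k h => le_of_abs_le (hbd i k h)) i k
    have hlow := hstab (W j - (M.sample fun x y => w x y (j * dt))) (P j) (hP0 j)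
      (fun i k hi hk => by
        rw [map_sub, Pi.sub_apply, Pi.sub_apply, hW.interior j hj i k hi hk, zero_sub]
        exact neg_le_neg (le_of_abs_le (htr _ (htime j hj) i k hi hk)))
      (fun i k h => le_of_abs_le (by
        have := hbd i k h
        rwa [abs_sub_comm] at this)) i k
    simp only [Pi.sub_apply, Mesh.sample] at hup hlow
    rw [abs_le, hε]
    constructor <;> linarith
  have hbase : ∀ j ≤ J, ∀ i, M.InnerCol i → |w (M.x i) 0 (j * dt) - W j i 0| ≤ P j := by
    intro j
    induction j with
    | zero =>
      intro hj i hi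
      rw [hW.initial i hi, Nat.cast_zero, zero_mul, hw.initial_eq _ (M.x_mem_Icc hX i)]
      simp [hP]
    | succ j ih =>
      intro hj i hi
      have hj' : j ≤ J := by omega
      have hjJ : j < J := by omega
      have hIo := M.x_mem_Ioo hX hi
      have hIc := M.x_mem_Icc hX i
      have h0Y : (0 : ℝ) ∈ Icc 0 Y := ⟨le_rfl, hY.le⟩
      have hK := M.K_pos
      set k₁ : Fin (M.K + 1) := ⟨1, by omega⟩ with hk₁
      have hyk : M.y k₁ = M.dx := by simp [Mesh.y, hk₁]
      -- The neighbour in row `1` carries the base error plus `ε`; if `K = 1` this row is the top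
      -- boundary.
      have hall := abs_le.1 (fill j hj' (ih hj') i k₁)
      have hb := abs_le.1 (ih hj' i hi)
      rw [hyk] at hall
      have hw0 : ∀ n ≤ J, 0 ≤ w (M.x i) 0 (n * dt) := fun n hn =>
        hw.nonneg _ hIc 0 h0Y _ (htime n hn)
      have hu : ∀ n ≤ J, w (M.x i) 0 (n * dt) ^ (1 / m) ∈ Icc 0 N := fun n hn =>
        ⟨Real.rpow_nonneg (hw0 n hn) _, hwN _ hIc _ (htime n hn)⟩
      have hU : ∀ n ≤ J, W n i 0 ^ (1 / m) ∈ Icc 0 N := fun n hn => by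
        refine ⟨Real.rpow_nonneg (hWN n hn i 0).1 _, ?_⟩
        have := Real.rpow_le_rpow (hWN n hn i 0).1 (hWN n hn i 0).2 (by positivity : 0 ≤ 1 / m)
        rwa [rpow_rpow_one_div hm0 hN0] at this
      have hdiff : ((j + 1 : ℕ) : ℝ) * dt - j * dt = dt := by push_cast; ring
      have hlt : (j : ℝ) * dt < ((j + 1 : ℕ) : ℝ) * dt := by linarith
      have hg := hgr _ hIo _ _ (htime j hj').1 hlt (htime _ hj).2
      have hc₀ := hcons _ hIo _ _ (htime j hj').1 hlt (htime _ hj).2 hdiff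
      rw [hdiff] at hg hc₀
      have hθ : 1 ≤ Real.exp (A * dt) := Real.one_le_exp (by positivity)
      have hroot := hW.root_step hm hN0 hl hcfl hWN hjJ hi (k₁ := k₁) rfl
      have hc₁ : |w (M.x i) 0 ((j + 1 : ℕ) * dt) ^ (1 / m) - (w (M.x i) 0 (j * dt) ^ (1 / m) +
          l * (w (M.x i) M.dx (j * dt) - (w (M.x i) 0 (j * dt) ^ (1 / m)) ^ m))| ≤ τ := by
        rw [rpow_one_div_rpow hm0 (hw0 j hj')]
        rwa [← sub_sub]
      have hup := step_error_upper hm hl hcfl hθ (hP0 j) hε0 hτ (hu j hj') (hu _ hj)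
        (hU j hj') (hU _ hj) hroot hc₁ hg (by linarith [hall.1]) (by
          rw [rpow_one_div_rpow hm0 (hw0 j hj'), rpow_one_div_rpow hm0 (hWN j hj' i 0).1]
          linarith [hb.1])
      have hlow := step_error_lower hm hl hcfl hθ (hP0 j) hε0 hτ (hu j hj') (hu _ hj)
        (hU j hj') (hU _ hj) hroot hc₁ hg (by linarith [hall.2]) (by
          rw [rpow_one_div_rpow hm0 (hw0 j hj'), rpow_one_div_rpow hm0 (hWN j hj' i 0).1]
          linarith [hb.2])
      rw [rpow_one_div_rpow hm0 (hw0 _ hj), rpow_one_div_rpow hm0 (hWN _ hj i 0).1] at hup hlow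
      have hPs : Real.exp (A * dt) ^ m * P j + η ≤ P (j + 1) := by
        have e₁ : Real.exp (A * dt) ^ m * P j =
            j * Real.exp (A * dt * m * ((j + 1 : ℕ) : ℝ)) * η := by
          simp only [hP]
          rw [← Real.exp_mul, show A * dt * m * ((j + 1 : ℕ) : ℝ) =
            A * dt * m + A * dt * m * j by push_cast; ring, Real.exp_add]
          ring
        have e₂ : 1 ≤ Real.exp (A * dt * m * ((j + 1 : ℕ) : ℝ)) :=
          Real.one_le_exp (by positivity)
        have e₃ := mul_le_mul_of_nonneg_right e₂ hη
        rw [e₁]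
        simp only [hP]
        push_cast at e₃ ⊢
        linarith
      rw [abs_le]
      constructor <;> linarith
  intro i k
  have h := fill J le_rfl (hbase J le_rfl) i k
  rw [hJT] at h
  have hPJ : P J = J * Real.exp (A * T * m) * η := by
    simp only [hP]
    rw [← hJT]
    ring_nf
  rwa [hPJ] at h


theorem rpow_le_rpow_mul_of_le {h H p q : ℝ} (hh : 0 < h) (hhH : h ≤ H) (hpq : p ≤ q) :
    h ^ q ≤ H ^ (q - p) * h ^ p := by
  rw [show q = (q - p) + p by ring, Real.rpow_add hh, add_sub_cancel_right]
  exact mul_le_mul_of_nonneg_right (Real.rpow_le_rpow hh.le hhH (sub_nonneg.2 hpq))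
    (Real.rpow_nonneg hh.le p)

/-- The error estimate for time steps with `Δt ≤ C(m, f) Δx^σ` and
`Δt ≤ G C(m, f) Δx^(2-σ)`. -/
theorem exists_error_bound {σ m X Y T a : ℝ} (hσ0 : 0 < σ) (hσ2 : σ < 2) (hm : 1 ≤ m)
    (hX : 0 < X) (hY : 0 < Y) (hT : 0 < T) {f : ℝ → ℝ} (hf : ∀ x ∈ Icc (-X) X, 0 ≤ f x)
    {w : ℝ → ℝ → ℝ → ℝ} (hw : IsClassicalSolution σ m X Y T f w)
    (hreg : IsRegular σ m X Y T w) {LD : Discretization X Y} (hmax : MaxPrinciple LD)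
    {R : Set (ℝ → ℝ → ℝ → ℝ)} (hwR : w ∈ R)
    (hpoly : ∀ c₀ c₁ c₂ c₃ c₄ c₅ : ℝ,
      (fun x y _ => c₀ + c₁ * x + c₂ * y + c₃ * x ^ 2 + c₄ * x * y + c₅ * y ^ 2) ∈ R)
    (ha : 2 ≤ a) (hord : HasOrder σ X Y T a LD R) (G : ℝ) :
    ∃ C : ℝ, ∀ (M : Mesh X Y) (J : ℕ), 0 < J → ∀ W : ℕ → M.Grid,
      IsNumericalSolution σ m f LD M J (T / J) W → StepBound σ m f M (T / J) σ →
      invC σ m X f * (T / J) ≤ G * M.dx ^ (2 - σ) →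
      errF w M (T / J) W J ≤ C * M.dx ^ (2 - σ) := by
  have hν := nu_pos hσ0 hσ2
  have h2σ : 0 < 2 - σ := by linarith
  obtain ⟨A, hA0, hgr⟩ := hreg.exists_growth hw hσ0 hσ2 hm hY
  obtain ⟨Cc, hCc0, hcons⟩ := hreg.exists_consistency hw hσ0 hσ2 hm hY
  obtain ⟨Ct, hCt0, htr⟩ := hw.exists_truncation hX hT hord hwR
  obtain ⟨δ, hδ0, S, hS0, hstab⟩ :=
    hord.exists_stability hmax hσ0 hX hY hT (by linarith) hpoly
  set N := supNorm X f with hN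
  have hbdd := hw.bddAbove_image hm hY hT hf
  have hfN : ∀ x ∈ Icc (-X) X, f x ≤ N := fun x hx => le_csSup hbdd ⟨x, hx, rfl⟩
  have hXm : X ∈ Icc (-X) X := ⟨by linarith, le_rfl⟩
  have hN0 : 0 ≤ N := (hf X hXm).trans (hfN X hXm)
  have hwN : ∀ x ∈ Icc (-X) X, ∀ t ∈ Icc 0 T, w x 0 t ^ (1 / m) ≤ N := fun x hx t ht =>
    hw.base_le_supNorm hσ0 hσ2 hm hY hT hf hx ht
  set Φ := m * N ^ (m - 1) with hΦ
  have hΦ0 : 0 ≤ Φ := mul_nonneg (by linarith) (Real.rpow_nonneg hN0 _)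
  -- The constant for fine meshes: base truncation, interior truncation fed into each step through
  -- `l ε`, and the final interior error `ε`.
  set C₁ := Real.exp (A * T * m) * (Cc * T * (G / nu σ + Φ) +
    Φ * nu σ * T * S * Ct * (2 * X) ^ (a - 2)) + S * Ct * (2 * X) ^ (a - (2 - σ)) with hC₁
  set C₂ := N ^ m * δ ^ (-(2 - σ)) with hC₂
  refine ⟨max C₁ C₂, ?_⟩
  intro M J hJ W hW hsb hG
  have hJ0 : (0 : ℝ) < J := by exact_mod_cast hJ
  set dt := T / J with hdt_def
  have hdt : 0 < dt := by positivity
  have hJT : J * dt = T := by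
    rw [hdt_def]
    field_simp
  have hdx := M.dx_pos hX
  have hdxσ : 0 < M.dx ^ σ := Real.rpow_pos_of_pos hdx σ
  have hdxp : 0 < M.dx ^ (2 - σ) := Real.rpow_pos_of_pos hdx _
  have hl : 0 ≤ nu σ * (dt / M.dx ^ σ) := by positivity
  have hcfl : nu σ * (dt / M.dx ^ σ) * Φ ≤ 1 := by
    have h : invC σ m X f * dt ≤ M.dx ^ σ := hsb
    have e : nu σ * (dt / M.dx ^ σ) * Φ = invC σ m X f * dt / M.dx ^ σ := by
      rw [hΦ, hN]
      unfold invC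
      ring
    rw [e]
    exact (div_le_one hdxσ).2 h
  have hWN := hW.mem_Icc hmax hm hX hf hfN hl hcfl
  unfold errF
  rw [hJT]
  refine ciSup_le fun p => ?_
  obtain ⟨i, k⟩ := p
  rcases le_or_gt M.dx δ with hfine | hcoarse
  · set τ := Cc * (dt ^ 2 + dt * M.dx ^ (2 - σ)) with hτ
    have herr := error_le_of_truncation hw hm hX hY hW hdt hJT (τ := τ) hN0 hA0
      (by positivity) (mul_nonneg hCt0 (Real.rpow_nonneg hdx.le a)) hS0 rfl hl hcfl hWN hwN hgr
      (fun x hx s t hs hst htT he => by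
        have := hcons x hx s t M.dx hs hst htT hdx (M.dx_le_height hX)
        rwa [he] at this ⊢)
      (htr M) (fun V b hb => hstab M hfine V b _ hb
        (mul_nonneg hCt0 (Real.rpow_nonneg hdx.le a))) i k
    refine herr.trans (le_trans ?_ (mul_le_mul_of_nonneg_right (le_max_left C₁ C₂) hdxp.le))
    -- Only `Φ Δt`, not `Δt`, is bounded: the step restriction is void when `Φ = 0`. The accumulated
    -- base error carries a factor `Φ`, so this suffices.
    have hGdt : Φ * dt ≤ G / nu σ * M.dx ^ (2 - σ) := by
      rw [div_mul_eq_mul_div, le_div_iff₀ hν]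
      calc Φ * dt * nu σ = invC σ m X f * dt := by
            rw [hΦ, hN]
            unfold invC
            ring
        _ ≤ _ := hG
    have hpa : M.dx ^ a = M.dx ^ (a - σ) * M.dx ^ σ := by
      rw [← Real.rpow_add hdx, sub_add_cancel]
    -- The factor `Δx^(-σ)` in `l` costs `σ` powers of the interior order; `a ≥ 2` is what leaves `2
    -- - σ`.
    have hp₁ : M.dx ^ (a - σ) ≤ (2 * X) ^ (a - 2) * M.dx ^ (2 - σ) := by
      have := rpow_le_rpow_mul_of_le hdx (M.dx_le_two_mul hX)
        (by linarith : 2 - σ ≤ a - σ)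
      rwa [show a - σ - (2 - σ) = a - 2 by ring] at this
    have hp₂ : M.dx ^ a ≤ (2 * X) ^ (a - (2 - σ)) * M.dx ^ (2 - σ) :=
      rpow_le_rpow_mul_of_le hdx (M.dx_le_two_mul hX) (by linarith)
    have hsum : J * Real.exp (A * T * m) *
        (Φ * (τ + nu σ * (dt / M.dx ^ σ) * (S * (Ct * M.dx ^ a)))) =
        Real.exp (A * T * m) * (Cc * T * (Φ * dt + Φ * M.dx ^ (2 - σ)) +
          Φ * nu σ * T * S * Ct * M.dx ^ (a - σ)) := by
      have e : dt / M.dx ^ σ * M.dx ^ a = dt * M.dx ^ (a - σ) := by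
        rw [hpa]
        field_simp
      calc J * Real.exp (A * T * m) *
            (Φ * (τ + nu σ * (dt / M.dx ^ σ) * (S * (Ct * M.dx ^ a))))
          = Real.exp (A * T * m) * (Cc * (J * dt) * (Φ * dt + Φ * M.dx ^ (2 - σ)) +
            J * Φ * nu σ * S * Ct * (dt / M.dx ^ σ * M.dx ^ a)) := by rw [hτ]; ring
        _ = Real.exp (A * T * m) * (Cc * (J * dt) * (Φ * dt + Φ * M.dx ^ (2 - σ)) +
            Φ * nu σ * (J * dt) * S * Ct * M.dx ^ (a - σ)) := by rw [e]; ring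
        _ = _ := by rw [hJT]
    rw [hsum]
    have hbig : Real.exp (A * T * m) * (Cc * T * (Φ * dt + Φ * M.dx ^ (2 - σ)) +
          Φ * nu σ * T * S * Ct * M.dx ^ (a - σ)) + S * (Ct * M.dx ^ a) ≤
        Real.exp (A * T * m) * (Cc * T * (G / nu σ * M.dx ^ (2 - σ) + Φ * M.dx ^ (2 - σ)) +
          Φ * nu σ * T * S * Ct * ((2 * X) ^ (a - 2) * M.dx ^ (2 - σ))) +
          S * (Ct * ((2 * X) ^ (a - (2 - σ)) * M.dx ^ (2 - σ))) := by
      gcongr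
    refine hbig.trans (le_of_eq ?_)
    rw [hC₁]
    ring
  -- On coarse meshes the barrier argument is not available, but both solutions lie in `[0, N^m]`
  -- and `Δx^(2-σ) ≥ δ^(2-σ)`.
  · have hTm : T ∈ Icc 0 T := ⟨hT.le, le_rfl⟩
    have hm0 : m ≠ 0 := by linarith
    have hNm : 0 ≤ N ^ m := Real.rpow_nonneg hN0 m
    have h₁ := hw.nonneg _ (M.x_mem_Icc hX i) _ (M.y_mem_Icc hX k) T hTm
    have h₂ : w (M.x i) (M.y k) T ≤ N ^ m := by
      refine hw.le_of_base_le hY ⟨hT, le_rfl⟩ hNm (fun x hx => ?_) (M.x_mem_Icc hX i)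
        (M.y_mem_Icc hX k)
      have h₀ := hw.nonneg x hx 0 ⟨le_rfl, hY.le⟩ T hTm
      have := Real.rpow_le_rpow (Real.rpow_nonneg h₀ _) (hwN x hx T hTm)
        (by linarith : 0 ≤ m)
      rwa [rpow_one_div_rpow hm0 h₀] at this
    have h₃ := hWN J le_rfl i k
    have h₄ : |w (M.x i) (M.y k) T - W J i k| ≤ N ^ m := by
      rw [abs_le]
      constructor <;> linarith [h₃.1, h₃.2]
    refine h₄.trans (le_trans ?_ (mul_le_mul_of_nonneg_right (le_max_right C₁ C₂) hdxp.le))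
    have h₅ : 1 ≤ δ ^ (-(2 - σ)) * M.dx ^ (2 - σ) := by
      rw [Real.rpow_neg hδ0.le, inv_mul_eq_div, one_le_div (Real.rpow_pos_of_pos hδ0 _)]
      exact Real.rpow_le_rpow hδ0.le hcoarse.le h2σ.le
    calc N ^ m = N ^ m * 1 := (mul_one _).symm
      _ ≤ N ^ m * (δ ^ (-(2 - σ)) * M.dx ^ (2 - σ)) := mul_le_mul_of_nonneg_left h₅ hNm
      _ = C₂ * M.dx ^ (2 - σ) := by rw [hC₂]; ring

end FracPME

open FracPME in
theorem mainTheorem7 (σ m X Y T : ℝ) (hσ0 : 0 < σ) (hσ2 : σ < 2) (hm : 1 ≤ m)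
    (hX : 0 < X) (hY : 0 < Y) (hT : 0 < T)
    (f : ℝ → ℝ) (hf : ∀ x ∈ Set.Icc (-X) X, 0 ≤ f x)
    (w : ℝ → ℝ → ℝ → ℝ) (hw : IsClassicalSolution σ m X Y T f w)
    (hreg : IsRegular σ m X Y T w)
    (LD : Discretization X Y) (hmax : MaxPrinciple LD)
    -- the class of functions that are regular enough for the discretization
    (R : Set (ℝ → ℝ → ℝ → ℝ)) (hwR : w ∈ R)
    (hpoly : ∀ c₀ c₁ c₂ c₃ c₄ c₅ : ℝ,
      (fun x y _ => c₀ + c₁ * x + c₂ * y + c₃ * x ^ 2 + c₄ * x * y + c₅ * y ^ 2) ∈ R) :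
    (σ ≤ 1 → HasOrder σ X Y T (2 * (2 - σ)) LD R →
      ∀ D : ℝ, 0 < D → ∃ C : ℝ, ∀ (M : Mesh X Y) (J : ℕ), 0 < J → ∀ W : ℕ → M.Grid,
        IsNumericalSolution σ m f LD M J (T / J) W →
        StepBound σ m f M (T / J) σ →
        D * M.dx ^ (2 - σ) ≤ T / J → StepBound σ m f M (T / J) (2 - σ) →
        errF w M (T / J) W J ≤ C * M.dx ^ (2 - σ)) ∧
    (1 < σ → HasOrder σ X Y T 2 LD R →
      ∀ D : ℝ, 0 < D → ∃ C : ℝ, ∀ (M : Mesh X Y) (J : ℕ), 0 < J → ∀ W : ℕ → M.Grid,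
        IsNumericalSolution σ m f LD M J (T / J) W →
        D * M.dx ^ σ ≤ T / J → StepBound σ m f M (T / J) σ →
        errF w M (T / J) W J ≤ C * M.dx ^ (2 - σ)) := by
  constructor
  · intro hσ1 hord D _
    -- For `σ ≤ 1` the order `2 (2 - σ)` is at least `2`, and `G = 1` is the bound on `Δt` itself.
    obtain ⟨C, hC⟩ := exists_error_bound hσ0 hσ2 hm hX hY hT hf hw hreg hmax hwR hpoly
      (by linarith) hord 1
    refine ⟨C, fun M J hJ W hW hsb _ hsb' => hC M J hJ W hW hsb ?_⟩
    rw [one_mul]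
    exact hsb'
  · intro hσ1 hord D _
    -- For `σ > 1` the exponent `σ` exceeds `2 - σ`, so `Δx ≤ 2X` gives `Δx^σ ≤ G Δx^(2-σ)` with
    -- this `G`.
    obtain ⟨C, hC⟩ := exists_error_bound hσ0 hσ2 hm hX hY hT hf hw hreg hmax hwR hpoly
      le_rfl hord ((2 * X) ^ (σ - (2 - σ)))
    refine ⟨C, fun M J hJ W hW _ hsb => hC M J hJ W hW hsb (le_trans hsb ?_)⟩
    exact rpow_le_rpow_mul_of_le (M.dx_pos hX) (M.dx_le_two_mul hX) (by linarith)
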